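/- **Stability of the closed-loop DC microgrid.** *Model.* Consider $N$ nodes and $M$ power lines forming a connected electrical graph with incidence matrix $B\in\mathbb R^{N\times M}$ (arbitrary orientation), and a connected undirected communication graph on the nodes with weights $a_{ij}=a_{ji}\ge 0$ and Laplacian $\mathcal L_c$, $(\mathcal L_c x)_i=\sum_j a_{ij}(x_i-x_j)$. Let $R_l,L_l>0$ be the line resistances and inductances, and for each node $i$ let $R_{ti},L_{ti},C_{ti}>0$ be the filter parameters, $I^s_{ti}>0$ the rated current, $V_{ref,i}>0$ the reference voltage, $Y_{Li}>0$ and $\bar I_{Li},P^*_{Li},r_i\in\mathbb R$ the load parameters, with $P^*_{Li}\ge 0$ whenever $r_i>1$. The load current is $I_{Li}(V_i)=Y_{Li}V_i+\bar I_{Li}+V_i^{r_i-1}P^*_{Li}$. For gains $k_{1,i},\dots,k_{4,i}\in\mathbb R$ the state $X=(V,I_t,v,I,\Omega)\in\mathbb R^{4N+M}$ obeys the closed-loop dynamics $$\begin{aligned} C_{ti}\dot V_i&=I_{ti}-I_{Li}(V_i)-(BI)_i,\\ L_{ti}\dot I_{ti}&=(k_{1,i}-1)V_i+(k_{2,i}-R_{ti})I_{ti}+k_{3,i}v_i+k_{4,i}\omega_i,\\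 \dot v_i&=V_{ref,i}-V_i-\omega_i,\\ L_l\dot I_l&=(B^TV)_l-R_lI_l,\\ \dot\Omega&=\mathcal L_c[I^s_t]^{-1}I_t,\qquad \omega=[I^s_t]^{-1}\mathcal L_c\Omega, \end{aligned}\tag{1}$$ where $[x]$ is the diagonal matrix with diagonal $x$. The primary-controlled system (2), in the state $X'=(V,I_t,v,I)\in\mathbb R^{3N+M}$, consists of the first four equations with $\omega=0$. Along (1) the sum $\sum_i\Omega_i$ is constant, and adding a common constant to all $\Omega_i$ maps equilibria to equilibria. *Assumptions.* For every $i$: $k_{1,i}<1$, $k_{2,i}<R_{ti}$, $0<k_{3,i}<\frac1{L_{ti}}(k_{1,i}-1)(k_{2,i}-R_{ti})$ and $k_{4,i}=k_{1,i}-1$. *Claims.* 1. Let $\bar V\in\mathbb R^N_{>0}$ satisfy the power-flow equations $$BR^{-1}B^T\bar V+\mathcal L_t[I^s_t]^{-1}\big(I_{Li}(\bar V_i)\big)_{i}=0,\qquad \sum_iI^s_{ti}\bar V_i=\sum_iI^s_{ti}V_{ref,i},$$ where $R$ is the diagonal matrix of the line resistances and $\mathcal L_t=[I^s_t]-(\sum_iI^s_{ti})^{-1}I^s_t(I^s_t)^T$,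 and suppose that $(1-r_i)\bar P^*_{Li}<Y_{Li}\bar V_i^2$ for every $i$ with $r_i<1$, where $\bar P^*_{Li}=P^*_{Li}\bar V_i^{r_i}$. Then (1) has an equilibrium with voltages $\bar V$, and for every such equilibrium $\bar X$: - $\bar X$ is Lyapunov stable in $\mathbb R^{4N+M}$; it is locally asymptotically stable on the invariant hyperplane $\{\sum_i\Omega_i=\sum_i\bar\Omega_i\}$; and every solution of (1) on $[0,\infty)$ that starts close enough to $\bar X$ converges to the equilibrium $\bar X+(0,0,0,0,\eta\mathbf 1_N)$, $\eta=\frac1N\sum_i(\Omega_i(0)-\bar\Omega_i)$. - If $\bar P^*_L=0$, then $\bar X$ is globally asymptotically stable on this hyperplane, and every solution of (1) on $[0,\infty)$ in $\mathbb R^{4N+M}$ converges to $\bar X+(0,0,0,0,\eta\mathbf 1_N)$ with $\eta$ as above. 2. (No communication network.) Suppose that $(1-r_i)P^*_{Li}V_{ref,i}^{r_i}<Y_{Li}V_{ref,i}^2$ for every $i$ with $r_i<1$. Then (2) has exactly one equilibrium $\bar X'$, and $\bar X'$ is locally asymptotically stable in $\mathbb R^{3N+M}$. Stability and asymptotic stability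 include that solutions from the initial states concerned exist for all $t\ge 0$. -/

import Mathlib

open scoped Topology Matrix

noncomputable section

/-! ### Stability notions for an autonomous ordinary differential equation `x' = f x`

All notions are relative to a set `S` of initial states; `S = Set.univ` gives the usual ones. -/

namespace ODEStability

variable {E : Type*} [NormedAddCommGroup E] [NormedSpace ℝ E]

/-- Every solution that starts in `S` stays in `S` as long as it exists. -/
def IsForwardInvariant (f : E → E) (S : Set E) : Prop :=
  ∀ (T : ℝ) (x : ℝ → E), 0 < T → IsIntegralCurveOn x (fun _ => f) (Set.Ico 0 T) → x 0 ∈ S →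
    ∀ t ∈ Set.Ico 0 T, x t ∈ S

/-- Lyapunov stability of `xbar` for initial states in `S`: from every such state close to `xbar`
a solution exists for all times `t ≥ 0`, and every solution, on whatever interval `[0, T)`,
stays close to `xbar`. -/
def IsStableOn (f : E → E) (S : Set E) (xbar : E) : Prop :=
  ∀ ε > 0, ∃ δ > 0, ∀ x₀ ∈ S, dist x₀ xbar < δ →
    (∃ x : ℝ → E, x 0 = x₀ ∧ IsIntegralCurveOn x (fun _ => f) (Set.Ici 0)) ∧
    ∀ (T : ℝ) (x : ℝ → E), 0 < T → x 0 = x₀ → IsIntegralCurveOn x (fun _ => f) (Set.Ico 0 T) →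
      ∀ t ∈ Set.Ico 0 T, dist (x t) xbar < ε

/-- Local asymptotic stability of `xbar` on the invariant set `S`. -/
def IsLocallyAsymptoticallyStableOn (f : E → E) (S : Set E) (xbar : E) : Prop :=
  IsForwardInvariant f S ∧ IsStableOn f S xbar ∧
    ∃ δ > 0, ∀ x : ℝ → E, IsIntegralCurveOn x (fun _ => f) (Set.Ici 0) → x 0 ∈ S →
      dist (x 0) xbar < δ → Filter.Tendsto x Filter.atTop (𝓝 xbar)

/-- Global asymptotic stability of `xbar` on the invariant set `S`. -/
def IsGloballyAsymptoticallyStableOn (f : E → E) (S : Set E) (xbar : E) : Prop :=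
  IsForwardInvariant f S ∧ IsStableOn f S xbar ∧
    (∀ x₀ ∈ S, ∃ x : ℝ → E, x 0 = x₀ ∧ IsIntegralCurveOn x (fun _ => f) (Set.Ici 0)) ∧
    ∀ x : ℝ → E, IsIntegralCurveOn x (fun _ => f) (Set.Ici 0) → x 0 ∈ S →
      Filter.Tendsto x Filter.atTop (𝓝 xbar)

end ODEStability

/-- A DC microgrid with `N` nodes (each carrying a generation unit and a load) and `M` power
lines, together with the weighted communication graph between the generation units. -/
structure Microgrid (N M : ℕ) where
  /-- source node of a line, for an arbitrary orientation -/
  src : Fin M → Fin N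
  /-- sink node of a line -/
  tgt : Fin M → Fin N
  src_ne_tgt : ∀ l, src l ≠ tgt l
  /-- the electrical graph is connected -/
  electrical_connected :
    (SimpleGraph.fromRel fun i j => ∃ l, src l = i ∧ tgt l = j).Connected
  /-- line resistances -/
  R : Fin M → ℝ
  R_pos : ∀ l, 0 < R l
  /-- line inductances -/
  L : Fin M → ℝ
  L_pos : ∀ l, 0 < L l
  /-- filter resistances -/
  Rt : Fin N → ℝ
  Rt_pos : ∀ i, 0 < Rt i
  /-- filter inductances -/
  Lt : Fin N → ℝ
  Lt_pos : ∀ i, 0 < Lt i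
  /-- filter capacitances -/
  Ct : Fin N → ℝ
  Ct_pos : ∀ i, 0 < Ct i
  /-- conductances of the Z loads -/
  YL : Fin N → ℝ
  YL_pos : ∀ i, 0 < YL i
  /-- currents of the I loads -/
  IL : Fin N → ℝ
  /-- power coefficients of the E loads -/
  PL : Fin N → ℝ
  /-- exponents of the E loads -/
  r : Fin N → ℝ
  /-- reference voltages -/
  Vref : Fin N → ℝ
  Vref_pos : ∀ i, 0 < Vref i
  /-- rated currents -/
  Is : Fin N → ℝ
  Is_pos : ∀ i, 0 < Is i
  /-- weights of the communication links -/
  a : Fin N → Fin N → ℝ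
  a_nonneg : ∀ i j, 0 ≤ a i j
  a_symm : ∀ i j, a i j = a j i
  /-- the communication graph is connected -/
  communication_connected : (SimpleGraph.fromRel fun i j => 0 < a i j).Connected

/-- Feedback gains of the primary controllers. -/
structure Gains (N : ℕ) where
  k₁ : Fin N → ℝ
  k₂ : Fin N → ℝ
  k₃ : Fin N → ℝ
  k₄ : Fin N → ℝ

/-- States `(V, It, v, I, Ω)` under primary and secondary control: node voltages, filter currents,
integrator states, line currents and consensus variables. -/
abbrev State (N M : ℕ) : Type :=
  (Fin N → ℝ) × (Fin N → ℝ) × (Fin N → ℝ) × (Fin M → ℝ) × (Fin N → ℝ)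

/-- States `(V, It, v, I)` under primary control only. -/
abbrev PrimaryState (N M : ℕ) : Type :=
  (Fin N → ℝ) × (Fin N → ℝ) × (Fin N → ℝ) × (Fin M → ℝ)

namespace Microgrid

variable {N M : ℕ} (G : Microgrid N M) (K : Gains N)

/-- Incidence matrix of the electrical graph. -/
def B : Matrix (Fin N) (Fin M) ℝ :=
  Matrix.of fun i l => if G.src l = i then 1 else if G.tgt l = i then -1 else 0

/-- Current drawn by the ZIE load at node `i` at voltage `V i`. -/
def loadCurrent (V : Fin N → ℝ) (i : Fin N) : ℝ :=
  G.YL i * V i + G.IL i + V i ^ (G.r i - 1) * G.PL i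

/-- Power absorbed by the E load at node `i` at voltage `V i`. -/
def ePower (V : Fin N → ℝ) (i : Fin N) : ℝ := G.PL i * V i ^ G.r i

/-- The Laplacian of the communication graph, as an operator. -/
def commLap (x : Fin N → ℝ) (i : Fin N) : ℝ := ∑ j, G.a i j * (x i - x j)

/-- The output `ω` of the secondary layer. -/
def omega (Ω : Fin N → ℝ) (i : Fin N) : ℝ := (G.Is i)⁻¹ * G.commLap Ω i

def alpha (i : Fin N) : ℝ := (K.k₁ i - 1) / G.Lt i
def beta (i : Fin N) : ℝ := (K.k₂ i - G.Rt i) / G.Lt i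
def gamma (i : Fin N) : ℝ := K.k₃ i / G.Lt i
def delta (i : Fin N) : ℝ := K.k₄ i / G.Lt i

/-- Right-hand side of the dynamics under primary and secondary control. -/
def closedLoop : State N M → State N M := fun (V, It, v, I, Ω) =>
  (fun i => (It i - G.loadCurrent V i - (G.B *ᵥ I) i) / G.Ct i,
   fun i => G.alpha K i * V i + G.beta K i * It i + G.gamma K i * v i
      + G.delta K i * G.omega Ω i,
   fun i => G.Vref i - V i - G.omega Ω i,
   fun l => ((G.Bᵀ *ᵥ V) l - G.R l * I l) / G.L l,
   fun i => G.commLap (fun j => It j / G.Is j) i)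

/-- Right-hand side of the dynamics under primary control only. -/
def primaryLoop : PrimaryState N M → PrimaryState N M := fun (V, It, v, I) =>
  (fun i => (It i - G.loadCurrent V i - (G.B *ᵥ I) i) / G.Ct i,
   fun i => G.alpha K i * V i + G.beta K i * It i + G.gamma K i * v i,
   fun i => G.Vref i - V i,
   fun l => ((G.Bᵀ *ᵥ V) l - G.R l * I l) / G.L l)

/-- Laplacian of the electrical network. -/
def Le : Matrix (Fin N) (Fin N) ℝ := G.B * Matrix.diagonal (fun l => (G.R l)⁻¹) * G.Bᵀ

/-- `[Is] - (1ᵀ [Is] 1)⁻¹ [Is] 1 1ᵀ [Is]`. -/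
def LtMat : Matrix (Fin N) (Fin N) ℝ :=
  Matrix.diagonal G.Is - (∑ i, G.Is i)⁻¹ • Matrix.vecMulVec G.Is G.Is

/-- `V` is a positive solution of the power-flow equations under proportional current sharing and
weighted voltage balancing. -/
structure IsPositivePowerFlowSolution (V : Fin N → ℝ) : Prop where
  pos : ∀ i, 0 < V i
  flow : G.Le *ᵥ V + (G.LtMat * Matrix.diagonal (fun i => (G.Is i)⁻¹)) *ᵥ G.loadCurrent V = 0
  balance : ∑ i, G.Is i * V i = ∑ i, G.Is i * G.Vref i

/-- Restriction on the E loads with exponent less than one, at the node voltages `V`. -/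
def LoadCondition (V : Fin N → ℝ) : Prop :=
  ∀ i, G.r i < 1 → (1 - G.r i) * G.ePower V i < G.YL i * V i ^ 2

/-- The admissible gains of the primary controllers. -/
structure AdmissibleGains : Prop where
  k₁_lt : ∀ i, K.k₁ i < 1
  k₂_lt : ∀ i, K.k₂ i < G.Rt i
  k₃_pos : ∀ i, 0 < K.k₃ i
  k₃_lt : ∀ i, K.k₃ i < 1 / G.Lt i * ((K.k₁ i - 1) * (K.k₂ i - G.Rt i))

end Microgrid

namespace State

variable {N M : ℕ}

def voltage (X : State N M) : Fin N → ℝ := X.1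

def consensus (X : State N M) : Fin N → ℝ := X.2.2.2.2

/-- The states whose consensus variables have the same sum as those of `Xbar`.
This sum is a conserved quantity of the closed-loop dynamics. -/
def leaf (Xbar : State N M) : Set (State N M) :=
  {X | ∑ i, X.consensus i = ∑ i, Xbar.consensus i}

/-- `Xbar` with all its consensus variables shifted by one common constant so that their sum is
that of `X₀`: the element of the line `Xbar + ℝ (0, 0, 0, 0, 1)` in the leaf of `X₀`. -/
def shiftTo (Xbar X₀ : State N M) : State N M :=
  (Xbar.1, Xbar.2.1, Xbar.2.2.1, Xbar.2.2.2.1,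
    fun i => Xbar.consensus i + (∑ j, (X₀.consensus j - Xbar.consensus j)) / N)

end State

end

/-!
For a suitable positive definite form `b`, the storage `b (X - Xbar) (X - Xbar) / 2` decreases along
the primary-controlled system at the rate `dissipation`: the power exchanged between filters, nodes
and lines cancels, and what remains is the damping by the load slopes, the line resistances and the
controllers. The condition `k₄ = k₁ - 1` makes the secondary layer act through the passive output
`It`, so it interconnects losslessly and the storage plus half the square norm of the consensus
error has the same decay. Loads are strictly monotone near the equilibrium, and on the whole space
when there are no E loads, so the balls around `Xbar` are controlled by this Lyapunov function.

Convergence is a cascade of applications of Barbalat's lemma. The dissipation tends to zero, which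
gives the limits of `V`, `I` and of `β It + γ v`; then the rate of `V` tends to zero, which gives
`It` and `v`; then the rate of `It` tends to zero, which gives the Laplacian of `Ω`. The Laplacian
determines `Ω` up to a common constant, and that constant is fixed by the conserved sum of `Ω`.
-/

noncomputable section

theorem eventually_mul_sq_le_of_hasDerivAt {h : ℝ → ℝ} {a c d : ℝ} (hcd : c < d)
    (hh : HasDerivAt h d a) : ∀ᶠ v in 𝓝 a, c * (v - a) ^ 2 ≤ (v - a) * (h v - h a) := by
  have hslope := (hasDerivAt_iff_tendsto_slope.1 hh).eventually_const_lt hcd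
  filter_upwards [eventually_nhdsWithin_iff.1 hslope] with v hv
  rcases eq_or_ne v a with rfl | hne
  · simp
  calc c * (v - a) ^ 2 ≤ slope h a v * (v - a) ^ 2 := by
        gcongr
        exact (hv hne).le
    _ = (v - a) * (h v - h a) := by
        have := sub_ne_zero.2 hne
        rw [slope_def_field]
        field_simp

theorem fst_mem_closedBall {α β : Type*} [PseudoMetricSpace α] [PseudoMetricSpace β] {x y : α × β}
    {r : ℝ} (hx : x ∈ Metric.closedBall y r) : x.1 ∈ Metric.closedBall y.1 r :=
  (le_max_left (dist x.1 y.1) (dist x.2 y.2)).trans hx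

theorem tendsto_zero_of_mul_sq_le {ι : Type*} {F : Filter ι} {u D : ι → ℝ} {k : ℝ} (hk : 0 < k)
    (hle : ∀ᶠ t in F, k * u t ^ 2 ≤ D t) (hD : Filter.Tendsto D F (𝓝 0)) :
    Filter.Tendsto u F (𝓝 0) := by
  have hupper : Filter.Tendsto (fun t => k⁻¹ * D t) F (𝓝 0) := by simpa using hD.const_mul k⁻¹
  have hsq : Filter.Tendsto (fun t => u t ^ 2) F (𝓝 0) :=
    squeeze_zero' (Filter.Eventually.of_forall fun t => sq_nonneg _)
      (hle.mono fun t ht => (le_inv_mul_iff₀ hk).2 ht) hupper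
  rw [tendsto_zero_iff_abs_tendsto_zero]
  simpa [Real.sqrt_sq_eq_abs, Function.comp_def] using hsq.sqrt

namespace ODEStability

open Set Filter Metric
open scoped NNReal

variable {E : Type*} [NormedAddCommGroup E] [NormedSpace ℝ E]

/-! ### Lyapunov functions -/

/-- `W` is a Lyapunov function for `x' = f x` at the point `xbar`: continuously differentiable,
zero at `xbar`, and not increasing along the vector field within distance `ρ` of `xbar`. Positive
definiteness is required in the quantitative form `c * dist x xbar ^ 2 ≤ W x` on the whole space, so
that the radius of an invariant ball can be read off the value of `W`. -/
structure IsLyapunovFunctionOn (f : E → E) (W : E → ℝ) (xbar : E) (c ρ : ℝ) : Prop where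
  pos : 0 < c
  contDiff : ContDiff ℝ 1 W
  map_eq_zero : W xbar = 0
  mul_sq_dist_le : ∀ x, c * dist x xbar ^ 2 ≤ W x
  fderiv_nonpos : ∀ x ∈ closedBall xbar ρ, fderiv ℝ W x (f x) ≤ 0

theorem hasDerivWithinAt_comp_integralCurve {F : Type*} [NormedAddCommGroup F] [NormedSpace ℝ F]
    {f : E → E} {W : E → F} (hW : Differentiable ℝ W) {s : Set ℝ} {x : ℝ → E}
    (hx : IsIntegralCurveOn x (fun _ => f) s) {t : ℝ} (ht : t ∈ s) :
    HasDerivWithinAt (fun τ => W (x τ)) (fderiv ℝ W (x t) (f (x t))) s t :=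
  (hW (x t)).hasFDerivAt.comp_hasDerivWithinAt t (hx t ht)

theorem exists_first_time_le {φ : ℝ → ℝ} {a b r : ℝ} (hφ : ContinuousOn φ (Icc a b)) (hab : a ≤ b)
    (hb : r ≤ φ b) : ∃ m ∈ Icc a b, r ≤ φ m ∧ ∀ t ∈ Ico a m, φ t < r := by
  have hcompact : IsCompact (Icc a b ∩ φ ⁻¹' Ici r) :=
    isCompact_Icc.of_isClosed_subset (hφ.preimage_isClosed_of_isClosed isClosed_Icc isClosed_Ici)
      inter_subset_left
  obtain ⟨m, ⟨hm, hrm⟩, hmin⟩ := hcompact.exists_isLeast ⟨b, ⟨hab, le_rfl⟩, hb⟩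
  refine ⟨m, hm, hrm, fun t ht => not_le.1 fun hrt => ?_⟩
  exact (hmin ⟨⟨ht.1, ht.2.le.trans hm.2⟩, hrt⟩).not_gt ht.2

theorem exists_pos_lt_mul_sq {c : ℝ} (hc : 0 < c) (w : ℝ) : ∃ r > 0, w < c * r ^ 2 := by
  have h : Tendsto (fun r : ℝ => c * r ^ 2) atTop atTop :=
    (tendsto_pow_atTop two_ne_zero).const_mul_atTop hc
  exact ((eventually_gt_atTop 0).and (h.eventually_gt_atTop w)).exists

namespace IsLyapunovFunctionOn

variable {f : E → E} {W : E → ℝ} {xbar : E} {c ρ r : ℝ} {x : ℝ → E}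

theorem differentiable (h : IsLyapunovFunctionOn f W xbar c ρ) : Differentiable ℝ W :=
  h.contDiff.differentiable one_ne_zero

theorem mono (h : IsLyapunovFunctionOn f W xbar c ρ) (hr : r ≤ ρ) :
    IsLyapunovFunctionOn f W xbar c r :=
  { h with fderiv_nonpos := fun x hx => h.fderiv_nonpos x (closedBall_subset_closedBall hr hx) }

theorem smul (h : IsLyapunovFunctionOn f W xbar c ρ) {χ : E → ℝ} (hχ : ∀ x, 0 ≤ χ x) :
    IsLyapunovFunctionOn (fun x => χ x • f x) W xbar c ρ :=
  { h with
    fderiv_nonpos := fun x hx => by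
      rw [map_smul]
      exact smul_nonpos_of_nonneg_of_nonpos (hχ x) (h.fderiv_nonpos x hx) }

theorem antitoneOn (h : IsLyapunovFunctionOn f W xbar c ρ) {s : Set ℝ} (hs : Convex ℝ s)
    (hx : IsIntegralCurveOn x (fun _ => f) s) (hball : ∀ t ∈ interior s, x t ∈ closedBall xbar ρ) :
    AntitoneOn (fun t => W (x t)) s :=
  antitoneOn_of_hasDerivWithinAt_nonpos hs
    (fun _ ht => (hasDerivWithinAt_comp_integralCurve h.differentiable hx ht).continuousWithinAt)
    (fun _ ht => (hasDerivWithinAt_comp_integralCurve h.differentiable hx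
      (interior_subset ht)).mono interior_subset)
    fun t ht => h.fderiv_nonpos _ (hball t ht)

theorem dist_lt (h : IsLyapunovFunctionOn f W xbar c ρ) (hρ : 0 ≤ ρ) {s : Set ℝ}
    (hs : s.OrdConnected) (h0s : (0 : ℝ) ∈ s) (hx : IsIntegralCurveOn x (fun _ => f) s)
    (h0 : W (x 0) < c * ρ ^ 2) {t : ℝ} (ht : t ∈ s) (ht0 : 0 ≤ t) : dist (x t) xbar < ρ := by
  by_contra! hfar
  have hsub : Icc 0 t ⊆ s := hs.out h0s ht
  have hcont : ContinuousOn (fun τ => dist (x τ) xbar) (Icc 0 t) :=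
    continuous_dist.comp_continuousOn ((hx.continuousOn.mono hsub).prodMk continuousOn_const)
  obtain ⟨m, hm, hρm, hbefore⟩ := exists_first_time_le hcont ht0 hfar
  have hdecr : W (x m) ≤ W (x 0) := by
    refine h.antitoneOn (convex_Icc 0 m) (hx.mono ((Icc_subset_Icc_right hm.2).trans hsub))
      (fun τ hτ => ?_) (left_mem_Icc.2 hm.1) (right_mem_Icc.2 hm.1) hm.1
    rw [interior_Icc] at hτ
    exact (hbefore τ (Ioo_subset_Ico_self hτ)).le
  refine h0.not_ge ?_
  calc c * ρ ^ 2 ≤ c * dist (x m) xbar ^ 2 := by have := h.pos; gcongr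
    _ ≤ W (x m) := h.mul_sq_dist_le _
    _ ≤ W (x 0) := hdecr

theorem mem_closedBall_of_lt (h : IsLyapunovFunctionOn f W xbar c ρ) (hρ : 0 ≤ ρ)
    (hx : IsIntegralCurveOn x (fun _ => f) (Ici 0)) (h0 : W (x 0) < c * ρ ^ 2) :
    ∀ t ∈ Ici (0 : ℝ), x t ∈ closedBall xbar ρ := fun _ ht =>
  (h.dist_lt hρ ordConnected_Ici self_mem_Ici hx h0 ht ht).le

theorem exists_pos_forall_lt (h : IsLyapunovFunctionOn f W xbar c ρ) (hr : 0 < r) :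
    ∃ δ > 0, ∀ x, dist x xbar < δ → W x < c * r ^ 2 := by
  have hpos : W xbar < c * r ^ 2 := by
    rw [h.map_eq_zero]
    exact mul_pos h.pos (pow_pos hr 2)
  exact eventually_nhds_iff.1 ((h.contDiff.continuous.tendsto xbar).eventually_lt_const hpos)

theorem exists_tendsto (h : IsLyapunovFunctionOn f W xbar c ρ)
    (hx : IsIntegralCurveOn x (fun _ => f) (Ici 0))
    (hball : ∀ t ∈ Ici (0 : ℝ), x t ∈ closedBall xbar ρ) :
    ∃ l, Tendsto (fun t => W (x t)) atTop (𝓝 l) := by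
  have hanti : AntitoneOn (fun t => W (x t)) (Ici 0) :=
    h.antitoneOn (convex_Ici 0) hx fun t ht => hball t (interior_subset ht)
  have hanti' : Antitone fun t => W (x (max t 0)) := fun s t hst =>
    hanti (le_max_right s 0) (le_max_right t 0) (max_le_max_right 0 hst)
  have hbdd : BddBelow (range fun t => W (x (max t 0))) :=
    ⟨0, forall_mem_range.2 fun t =>
      (mul_nonneg h.pos.le (sq_nonneg _)).trans (h.mul_sq_dist_le _)⟩
  refine ⟨_, (tendsto_atTop_ciInf hanti' hbdd).congr' ?_⟩
  filter_upwards [eventually_ge_atTop 0] with t ht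
  rw [max_eq_left ht]

end IsLyapunovFunctionOn

/-! ### Global existence -/

theorem eqOn_Icc_of_isIntegralCurveOn {g : E → E} {k : ℝ≥0} (hg : LipschitzWith k g) {a b : ℝ}
    {x y : ℝ → E} (hx : IsIntegralCurveOn x (fun _ => g) (Icc a b))
    (hy : IsIntegralCurveOn y (fun _ => g) (Icc a b)) (h : x a = y a) : EqOn x y (Icc a b) := by
  have hright : ∀ {z : ℝ → E}, IsIntegralCurveOn z (fun _ => g) (Icc a b) →
      ∀ t ∈ Ico a b, HasDerivWithinAt z (g (z t)) (Ici t) t := fun hz t ht =>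
    (hz t (Ico_subset_Icc_self ht)).mono_of_mem_nhdsWithin
      (mem_of_superset (Icc_mem_nhdsGE ht.2) (Icc_subset_Icc_left ht.1))
  exact ODE_solution_unique (fun _ => hg) hx.continuousOn (hright hx) hy.continuousOn (hright hy) h

theorem exists_integralCurveOn_Ici_of_forall_Icc {g : E → E} {k : ℝ≥0} (hg : LipschitzWith k g)
    {x₀ : E} (h : ∀ T : ℝ, ∃ x : ℝ → E, x 0 = x₀ ∧ IsIntegralCurveOn x (fun _ => g) (Icc 0 T)) :
    ∃ x : ℝ → E, x 0 = x₀ ∧ IsIntegralCurveOn x (fun _ => g) (Ici 0) := by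
  choose y hy0 hy using h
  have hglue : ∀ T, EqOn (fun t => y (t + 1) t) (y T) (Ico 0 T) := fun T t ht =>
    eqOn_Icc_of_isIntegralCurveOn hg
      ((hy (t + 1)).mono (Icc_subset_Icc_right (by linarith)))
      ((hy T).mono (Icc_subset_Icc_right ht.2.le)) ((hy0 _).trans (hy0 _).symm)
      (right_mem_Icc.2 ht.1)
  refine ⟨fun t => y (t + 1) t, hy0 _, fun t (ht : 0 ≤ t) => ?_⟩
  have htmem : t ∈ Ico 0 (t + 1) := ⟨ht, lt_add_one t⟩
  have hnhds : Ico 0 (t + 1) ∈ 𝓝[Ici 0] t := by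
    rw [← Ici_inter_Iio]
    exact inter_mem self_mem_nhdsWithin (mem_nhdsWithin_of_mem_nhds (Iio_mem_nhds htmem.2))
  exact (((hy (t + 1)).mono Ico_subset_Icc_self t htmem).congr (hglue _)
    (hglue _ htmem)).mono_of_mem_nhdsWithin hnhds

theorem exists_integralCurveOn_Ici_of_lipschitzWith [CompleteSpace E] {g : E → E} {k C : ℝ≥0}
    (hg : LipschitzWith k g) (hC : ∀ x, ‖g x‖ ≤ C) (x₀ : E) :
    ∃ x : ℝ → E, x 0 = x₀ ∧ IsIntegralCurveOn x (fun _ => g) (Ici 0) := by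
  refine exists_integralCurveOn_Ici_of_forall_Icc hg fun T => ?_
  have hPicard : IsPicardLindelof (fun _ => g) (⟨0, le_rfl, abs_nonneg T⟩ : Icc 0 |T|) x₀
      (C * Real.nnabs T) 0 C k :=
    { lipschitzOnWith := fun _ _ => hg.lipschitzOnWith
      continuousOn := fun _ _ => continuousOn_const
      norm_le := fun _ _ x _ => hC x
      mul_max_le := by simp }
  obtain ⟨x, hx0, hx⟩ := hPicard.exists_eq_forall_mem_Icc_hasDerivWithinAt₀
  exact ⟨x, hx0, IsIntegralCurveOn.mono hx (Icc_subset_Icc_right (le_abs_self T))⟩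

theorem exists_lipschitzWith_contDiffBump_smul [FiniteDimensional ℝ E] {f : E → E} {xbar : E}
    (χ : ContDiffBump xbar) (hf : ∀ x ∈ closedBall xbar χ.rOut, ContDiffAt ℝ 1 f x) :
    ∃ k C : ℝ≥0, LipschitzWith k (fun x => χ x • f x) ∧ ∀ x, ‖χ x • f x‖ ≤ C := by
  have hsupp : tsupport (fun x => χ x • f x) ⊆ closedBall xbar χ.rOut :=
    (tsupport_smul_subset_left _ _).trans χ.tsupport_eq.subset
  have hcompact : HasCompactSupport fun x => χ x • f x :=
    (isCompact_closedBall _ _).of_isClosed_subset (isClosed_tsupport _) hsupp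
  have hsmooth : ContDiff ℝ 1 fun x => χ x • f x := contDiff_iff_contDiffAt.2 fun x => by
    by_cases hx : x ∈ tsupport fun x => χ x • f x
    · exact χ.contDiff.contDiffAt.smul (hf x (hsupp hx))
    · exact contDiffAt_const.congr_of_eventuallyEq (notMem_tsupport_iff_eventuallyEq.1 hx)
  obtain ⟨k, hk⟩ := hsmooth.lipschitzWith_of_hasCompactSupport hcompact one_ne_zero
  obtain ⟨C, hC⟩ := hsmooth.continuous.bounded_above_of_compact_support hcompact
  exact ⟨k, C.toNNReal, hk, fun x => (hC x).trans (Real.le_coe_toNNReal C)⟩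

namespace IsLyapunovFunctionOn

variable [FiniteDimensional ℝ E] {f : E → E} {W : E → ℝ} {xbar : E} {c ρ : ℝ}

/- The cut-off field `χ • f` agrees with `f` on the ball of radius `r`, which its solution from `x₀`
cannot leave because `W` is a Lyapunov function for it as well. -/
theorem exists_integralCurveOn_Ici (h : IsLyapunovFunctionOn f W xbar c ρ)
    (hf : ∀ x ∈ closedBall xbar ρ, ContDiffAt ℝ 1 f x) {r : ℝ} (hr : 0 < r) (hrρ : r < ρ) {x₀ : E}
    (h0 : W x₀ < c * r ^ 2) :
    ∃ x : ℝ → E, x 0 = x₀ ∧ IsIntegralCurveOn x (fun _ => f) (Ici 0) := by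
  let χ : ContDiffBump xbar := ⟨r, ρ, hr, hrρ⟩
  obtain ⟨k, C, hk, hC⟩ := exists_lipschitzWith_contDiffBump_smul χ hf
  obtain ⟨x, rfl, hx⟩ := exists_integralCurveOn_Ici_of_lipschitzWith hk hC x₀
  have hball := ((h.mono hrρ.le).smul fun _ => χ.nonneg).mem_closedBall_of_lt hr.le hx h0
  refine ⟨x, rfl, fun t ht => ?_⟩
  simpa only [χ.one_of_mem_closedBall (hball t ht), one_smul] using hx t ht

theorem isStableOn (h : IsLyapunovFunctionOn f W xbar c ρ) (hρ : 0 < ρ)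
    (hf : ∀ x ∈ closedBall xbar ρ, ContDiffAt ℝ 1 f x) (S : Set E) : IsStableOn f S xbar := by
  intro ε hε
  have hr : 0 < min ε (ρ / 2) := lt_min hε (half_pos hρ)
  have hrρ : min ε (ρ / 2) < ρ := (min_le_right _ _).trans_lt (half_lt_self hρ)
  obtain ⟨δ, hδ, hWδ⟩ := h.exists_pos_forall_lt hr
  refine ⟨δ, hδ, fun x₀ _ hx₀ => ⟨h.exists_integralCurveOn_Ici hf hr hrρ (hWδ _ hx₀), ?_⟩⟩
  rintro T x hT rfl hx t ht
  exact ((h.mono hrρ.le).dist_lt hr.le ordConnected_Ico (left_mem_Ico.2 hT) hx (hWδ _ hx₀)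
    ht ht.1).trans_le (min_le_left _ _)

end IsLyapunovFunctionOn

/-! ### Barbalat's lemma -/

section Barbalat

variable {F : Type*} [NormedAddCommGroup F] [NormedSpace ℝ F]

theorem norm_sub_smul_le_of_forall_norm_sub_le {φ u : ℝ → F} {a b ε : ℝ} (hab : a ≤ b)
    (hφ : ∀ s ∈ Icc a b, HasDerivWithinAt φ (u s) (Icc a b) s)
    (hu : ∀ s ∈ Icc a b, ‖u s - u a‖ ≤ ε) : ‖φ b - φ a - (b - a) • u a‖ ≤ ε * (b - a) := by
  have hder : ∀ s ∈ Icc a b,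
      HasDerivWithinAt (fun s => φ s - s • u a) (u s - u a) (Icc a b) s := fun s hs => by
    simpa using (hφ s hs).fun_sub ((hasDerivWithinAt_id s _).smul_const (u a))
  have hmvt := (convex_Icc a b).norm_image_sub_le_of_norm_hasDerivWithin_le hder hu
    (left_mem_Icc.2 hab) (right_mem_Icc.2 hab)
  rw [Real.norm_of_nonneg (sub_nonneg.2 hab)] at hmvt
  rwa [sub_smul, sub_sub_sub_comm]

theorem tendsto_deriv_zero_of_uniformContinuousOn {φ u : ℝ → F} {l : F}
    (hφ : ∀ t ∈ Ici (0 : ℝ), HasDerivWithinAt φ (u t) (Ici 0) t)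
    (hu : UniformContinuousOn u (Ici 0)) (hl : Tendsto φ atTop (𝓝 l)) :
    Tendsto u atTop (𝓝 0) := by
  refine tendsto_zero_iff_norm_tendsto_zero.2 (tendsto_order.2 ⟨fun ε hε =>
    Eventually.of_forall fun t => hε.trans_le (norm_nonneg _), fun ε hε => ?_⟩)
  obtain ⟨δ, hδ, hclose⟩ := uniformContinuousOn_iff_le.1 hu (ε / 2) (half_pos hε)
  have hincr : Tendsto (fun t => ‖φ (t + δ) - φ t‖) atTop (𝓝 0) := by
    simpa using ((hl.comp (tendsto_atTop_add_const_right _ δ tendsto_id)).sub hl).norm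
  filter_upwards [hincr.eventually_lt_const (by positivity : 0 < ε / 2 * δ),
    eventually_ge_atTop 0] with t hsmall ht
  have hsub : Icc t (t + δ) ⊆ Ici 0 := fun s hs => ht.trans hs.1
  have hslope : ‖φ (t + δ) - φ t - δ • u t‖ ≤ ε / 2 * δ := by
    have := norm_sub_smul_le_of_forall_norm_sub_le (le_add_of_nonneg_right hδ.le)
      (fun s hs => (hφ s (hsub hs)).mono hsub) (ε := ε / 2) fun s hs => by
        rw [← dist_eq_norm]
        refine hclose s (hsub hs) t ht ?_
        rw [Real.dist_eq, abs_of_nonneg (sub_nonneg.2 hs.1)]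
        linarith [hs.2]
    rwa [add_sub_cancel_left] at this
  have hbound : δ * ‖u t‖ < δ * ε :=
    calc δ * ‖u t‖ = ‖(φ (t + δ) - φ t) - (φ (t + δ) - φ t - δ • u t)‖ := by
          rw [sub_sub_cancel, norm_smul, Real.norm_of_nonneg hδ.le]
      _ ≤ ‖φ (t + δ) - φ t‖ + ‖φ (t + δ) - φ t - δ • u t‖ := norm_sub_le _ _
      _ < ε / 2 * δ + ε / 2 * δ := add_lt_add_of_lt_of_le hsmall hslope
      _ = δ * ε := by ring
  exact lt_of_mul_lt_mul_left hbound hδ.le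

variable {f : E → E} {s : Set E} {x : ℝ → E}

theorem uniformContinuousOn_comp_integralCurve {F : Type*} [UniformSpace F] (hs : IsCompact s)
    (hf : ContinuousOn f s) (hx : IsIntegralCurveOn x (fun _ => f) (Ici 0))
    (hxs : MapsTo x (Ici 0) s) {g : E → F} (hg : ContinuousOn g s) :
    UniformContinuousOn (fun t => g (x t)) (Ici 0) := by
  obtain ⟨C, hC⟩ := hs.exists_bound_of_continuousOn hf
  have hlip : LipschitzOnWith C.toNNReal x (Ici 0) :=
    (convex_Ici 0).lipschitzOnWith_of_nnnorm_hasDerivWithin_le hx fun t ht =>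
      NNReal.le_toNNReal_of_coe_le (hC _ (hxs ht))
  exact (hs.uniformContinuousOn_of_continuous hg).comp hlip.uniformContinuousOn hxs

theorem tendsto_map_vectorField_zero (hs : IsCompact s) (hf : ContinuousOn f s)
    (hx : IsIntegralCurveOn x (fun _ => f) (Ici 0)) (hxs : MapsTo x (Ici 0) s) (A : E →L[ℝ] F)
    {a : F} (hA : Tendsto (fun t => A (x t)) atTop (𝓝 a)) :
    Tendsto (fun t => A (f (x t))) atTop (𝓝 0) :=
  tendsto_deriv_zero_of_uniformContinuousOn
    (fun t ht => A.hasFDerivAt.comp_hasDerivWithinAt t (hx t ht))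
    (uniformContinuousOn_comp_integralCurve hs hf hx hxs (A.continuous.comp_continuousOn hf)) hA

theorem IsLyapunovFunctionOn.tendsto_fderiv_zero [ProperSpace E] {W : E → ℝ} {xbar : E} {c ρ : ℝ}
    (h : IsLyapunovFunctionOn f W xbar c ρ) (hf : ContinuousOn f (closedBall xbar ρ))
    (hx : IsIntegralCurveOn x (fun _ => f) (Ici 0))
    (hball : ∀ t ∈ Ici (0 : ℝ), x t ∈ closedBall xbar ρ) :
    Tendsto (fun t => fderiv ℝ W (x t) (f (x t))) atTop (𝓝 0) := by
  obtain ⟨l, hl⟩ := h.exists_tendsto hx hball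
  exact tendsto_deriv_zero_of_uniformContinuousOn
    (fun t ht => hasDerivWithinAt_comp_integralCurve h.differentiable hx ht)
    (uniformContinuousOn_comp_integralCurve (isCompact_closedBall xbar ρ) hf hx hball
      ((h.contDiff.continuous_fderiv one_ne_zero).continuousOn.clm_apply hf)) hl

end Barbalat

/-! ### Quadratic Lyapunov functions -/

section Quadratic

variable [FiniteDimensional ℝ E] {b : LinearMap.BilinForm ℝ E}

/-- The quadratic function of the symmetric form `b` centred at `xbar`, normalised so that its
derivative at `x` is `b (x - xbar)`. -/
def quadraticStorage (b : LinearMap.BilinForm ℝ E) (xbar x : E) : ℝ :=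
  b (x - xbar) (x - xbar) / 2

theorem exists_pos_mul_sq_norm_le (hb : ∀ x ≠ 0, 0 < b x x) :
    ∃ c > 0, ∀ x, c * ‖x‖ ^ 2 ≤ b x x := by
  have hcont : Continuous fun x => b x x :=
    b.toContinuousBilinearMap.isBoundedBilinearMap.continuous.comp
      (continuous_id.prodMk continuous_id)
  have hscale : ∀ x, x ≠ 0 → b x x = ‖x‖ ^ 2 * b (‖x‖⁻¹ • x) (‖x‖⁻¹ • x) := fun x hx => by
    have := norm_ne_zero_iff.2 hx
    simp only [map_smul, LinearMap.smul_apply, smul_eq_mul]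
    field_simp
  have hunit : ∀ x : E, x ≠ 0 → ‖x‖⁻¹ • x ∈ sphere (0 : E) 1 := fun x hx => by
    simp [norm_smul, hx]
  rcases subsingleton_or_nontrivial E with _ | _
  · exact ⟨1, one_pos, fun x => by simp [Subsingleton.elim x 0]⟩
  obtain ⟨y, hy, hmin⟩ := (isCompact_sphere (0 : E) 1).exists_isMinOn
    (NormedSpace.sphere_nonempty.2 zero_le_one) hcont.continuousOn
  refine ⟨b y y, hb y (ne_of_mem_sphere hy one_ne_zero), fun x => ?_⟩
  rcases eq_or_ne x 0 with rfl | hx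
  · simp
  rw [hscale x hx, mul_comm]
  gcongr
  exact hmin (hunit x hx)

theorem contDiff_quadraticStorage (b : LinearMap.BilinForm ℝ E) (xbar : E) :
    ContDiff ℝ 1 (quadraticStorage b xbar) :=
  (b.toContinuousBilinearMap.isBoundedBilinearMap.contDiff.comp
    ((contDiff_id.sub contDiff_const).prodMk (contDiff_id.sub contDiff_const))).div_const 2

theorem fderiv_quadraticStorage (hsymm : b.IsSymm) (xbar x v : E) :
    fderiv ℝ (quadraticStorage b xbar) x v = b (x - xbar) v := by
  have hsub : HasFDerivAt (fun y => y - xbar) (ContinuousLinearMap.id ℝ E) x :=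
    (hasFDerivAt_id x).sub_const xbar
  have hder := (b.toContinuousBilinearMap.hasFDerivAt_of_bilinear hsub hsub).mul_const (2⁻¹ : ℝ)
  have hstorage : quadraticStorage b xbar = fun y => b (y - xbar) (y - xbar) * 2⁻¹ :=
    funext fun y => div_eq_mul_inv _ _
  rw [hstorage]
  refine (congrArg (· v) hder.fderiv).trans ?_
  change 2⁻¹ * (b (x - xbar) v + b v (x - xbar)) = b (x - xbar) v
  rw [hsymm.eq v]
  ring

theorem exists_isLyapunovFunctionOn_quadraticStorage (hsymm : b.IsSymm) (hb : ∀ x ≠ 0, 0 < b x x)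
    (xbar : E) : ∃ c > 0, ∀ (f : E → E) (ρ : ℝ),
      (∀ x ∈ closedBall xbar ρ, b (x - xbar) (f x) ≤ 0) →
      IsLyapunovFunctionOn f (quadraticStorage b xbar) xbar c ρ := by
  obtain ⟨c, hc, hle⟩ := exists_pos_mul_sq_norm_le hb
  refine ⟨c / 2, half_pos hc, fun f ρ hdecr =>
    ⟨half_pos hc, contDiff_quadraticStorage b xbar, by simp [quadraticStorage], fun x => ?_,
      fun x hx => ?_⟩⟩
  · rw [dist_eq_norm, div_mul_eq_mul_div]
    exact div_le_div_of_nonneg_right (hle _) zero_le_two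
  · rw [fderiv_quadraticStorage hsymm]
    exact hdecr x hx

theorem IsLyapunovFunctionOn.tendsto_bilinForm_zero {f : E → E} {xbar : E} {c ρ : ℝ}
    (hsymm : b.IsSymm) (h : IsLyapunovFunctionOn f (quadraticStorage b xbar) xbar c ρ)
    (hf : ContinuousOn f (closedBall xbar ρ)) {x : ℝ → E}
    (hx : IsIntegralCurveOn x (fun _ => f) (Ici 0))
    (hball : ∀ t ∈ Ici (0 : ℝ), x t ∈ closedBall xbar ρ) :
    Tendsto (fun t => b (x t - xbar) (f (x t))) atTop (𝓝 0) := by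
  have := FiniteDimensional.proper_real E
  simpa only [fderiv_quadraticStorage hsymm] using h.tendsto_fderiv_zero hf hx hball

end Quadratic

end ODEStability

/-! ### The networks -/

namespace Microgrid

open Filter

variable {N M : ℕ} (G : Microgrid N M)

section CommunicationLaplacian

/-- The communication Laplacian as a linear map, to use linear algebra on `Microgrid.commLap`. -/
def commLapLin : (Fin N → ℝ) →ₗ[ℝ] (Fin N → ℝ) where
  toFun := G.commLap
  map_add' x y := by
    ext i
    simp only [commLap, Pi.add_apply, ← Finset.sum_add_distrib]
    exact Finset.sum_congr rfl fun j _ => by ring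
  map_smul' t x := by
    ext i
    simp only [commLap, Pi.smul_apply, smul_eq_mul, RingHom.id_apply, Finset.mul_sum]
    exact Finset.sum_congr rfl fun j _ => by ring

theorem commLap_sub (x y : Fin N → ℝ) : G.commLap (x - y) = G.commLap x - G.commLap y :=
  map_sub G.commLapLin x y

theorem commLap_add_const (x : Fin N → ℝ) (η : ℝ) :
    G.commLap (fun i => x i + η) = G.commLap x := by
  ext i
  simp [commLap]

theorem sum_mul_commLap (x y : Fin N → ℝ) :
    ∑ i, x i * G.commLap y i = (∑ i, ∑ j, G.a i j * ((x i - x j) * (y i - y j))) / 2 := by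
  have expand : ∑ i, x i * G.commLap y i = ∑ i, ∑ j, G.a i j * (x i * (y i - y j)) := by
    simp only [commLap, Finset.mul_sum, mul_left_comm]
  have swap : ∑ i, ∑ j, G.a i j * (x i * (y i - y j))
      = ∑ i, ∑ j, G.a i j * (x j * (y j - y i)) := by
    rw [Finset.sum_comm]
    simp only [G.a_symm]
  have symmetrize : ∑ i, ∑ j, G.a i j * ((x i - x j) * (y i - y j))
      = ∑ i, ∑ j, G.a i j * (x i * (y i - y j))
        + ∑ i, ∑ j, G.a i j * (x j * (y j - y i)) := by
    simp only [← Finset.sum_add_distrib]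
    exact Finset.sum_congr rfl fun i _ => Finset.sum_congr rfl fun j _ => by ring
  rw [symmetrize, ← swap, expand, add_self_div_two]

theorem sum_mul_commLap_comm (x y : Fin N → ℝ) :
    ∑ i, x i * G.commLap y i = ∑ i, G.commLap x i * y i := by
  simp only [mul_comm (G.commLap x _), sum_mul_commLap, mul_comm (x _ - x _)]

theorem sum_commLap (x : Fin N → ℝ) : ∑ i, G.commLap x i = 0 := by
  simpa using G.sum_mul_commLap (fun _ => 1) x

variable {G}

theorem eq_of_commLap_eq_zero_of_pos {x : Fin N → ℝ} (hx : G.commLap x = 0) {i j : Fin N}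
    (hij : 0 < G.a i j) : x i = x j := by
  have term_nonneg (i j) : 0 ≤ G.a i j * ((x i - x j) * (x i - x j)) :=
    mul_nonneg (G.a_nonneg i j) (mul_self_nonneg _)
  have energy_eq_zero : ∑ i, ∑ j, G.a i j * ((x i - x j) * (x i - x j)) = 0 := by
    simpa [hx] using (G.sum_mul_commLap x x).symm
  have row_eq_zero : ∑ j, G.a i j * ((x i - x j) * (x i - x j)) = 0 :=
    (Finset.sum_eq_zero_iff_of_nonneg fun i _ => Finset.sum_nonneg fun j _ => term_nonneg i j).1
      energy_eq_zero i (Finset.mem_univ i)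
  have term_eq_zero : G.a i j * ((x i - x j) * (x i - x j)) = 0 :=
    (Finset.sum_eq_zero_iff_of_nonneg fun j _ => term_nonneg i j).1 row_eq_zero j
      (Finset.mem_univ j)
  exact sub_eq_zero.1 (mul_self_eq_zero.1 ((mul_eq_zero.1 term_eq_zero).resolve_left hij.ne'))

theorem eq_of_commLap_eq_zero {x : Fin N → ℝ} (hx : G.commLap x = 0) (i j : Fin N) :
    x i = x j := by
  obtain ⟨walk⟩ := G.communication_connected.preconnected i j
  induction walk with
  | nil => rfl
  | cons hadj _ ih =>
    rw [SimpleGraph.fromRel_adj] at hadj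
    exact (hadj.2.elim (eq_of_commLap_eq_zero_of_pos hx)
      fun hpos => (eq_of_commLap_eq_zero_of_pos hx hpos).symm).trans ih

variable (G)

theorem natCast_ne_zero {N M : ℕ} (G : Microgrid N M) : (N : ℝ) ≠ 0 := by
  obtain ⟨i⟩ := G.communication_connected.nonempty
  exact Nat.cast_ne_zero.2 i.pos.ne'

/-- The communication Laplacian plus the all-ones matrix: it is invertible, and agrees with the
Laplacian on vectors of zero sum. -/
def commLapAddOnes : (Fin N → ℝ) →ₗ[ℝ] (Fin N → ℝ) :=
  G.commLapLin + LinearMap.pi fun _ => ∑ j, LinearMap.proj j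

theorem commLapAddOnes_apply (x : Fin N → ℝ) (i : Fin N) :
    G.commLapAddOnes x i = G.commLap x i + ∑ j, x j := by
  simp [commLapAddOnes, commLapLin]

theorem commLapAddOnes_of_sum_eq_zero {x : Fin N → ℝ} (hx : ∑ i, x i = 0) :
    G.commLapAddOnes x = G.commLap x := by
  ext i
  rw [commLapAddOnes_apply, hx, add_zero]

theorem sum_eq_zero_of_sum_commLapAddOnes {x : Fin N → ℝ}
    (hx : ∑ i, G.commLapAddOnes x i = 0) : ∑ i, x i = 0 := by
  simpa [commLapAddOnes_apply, Finset.sum_add_distrib, sum_commLap, G.natCast_ne_zero] using hx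

theorem ker_commLapAddOnes : LinearMap.ker G.commLapAddOnes = ⊥ := by
  refine LinearMap.ker_eq_bot'.2 fun x hx => ?_
  have hsum : ∑ j, x j = 0 := G.sum_eq_zero_of_sum_commLapAddOnes (by simp [hx])
  have hlap : G.commLap x = 0 := by rw [← G.commLapAddOnes_of_sum_eq_zero hsum, hx]
  ext i
  have hcard : N * x i = 0 := by
    rw [← hsum, Finset.sum_congr rfl fun j _ => eq_of_commLap_eq_zero hlap j i]
    simp
  exact (mul_eq_zero.1 hcard).resolve_left G.natCast_ne_zero

theorem exists_commLap_eq {b : Fin N → ℝ} (hb : ∑ i, b i = 0) : ∃ x, G.commLap x = b := by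
  obtain ⟨x, hx⟩ :=
    LinearMap.injective_iff_surjective.1 (LinearMap.ker_eq_bot.1 G.ker_commLapAddOnes) b
  have hsum : ∑ i, x i = 0 := G.sum_eq_zero_of_sum_commLapAddOnes (by rw [hx, hb])
  exact ⟨x, by rw [← hx, G.commLapAddOnes_of_sum_eq_zero hsum]⟩

theorem tendsto_of_commLap {ι : Type*} {F : Filter ι} {x : ι → Fin N → ℝ} {y : Fin N → ℝ}
    (hsum : ∀ᶠ t in F, ∑ i, x t i = ∑ i, y i)
    (hlap : Tendsto (fun t => G.commLap (x t)) F (𝓝 (G.commLap y))) : Tendsto x F (𝓝 y) := by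
  rw [(LinearMap.isClosedEmbedding_of_injective G.ker_commLapAddOnes).isInducing.tendsto_nhds_iff,
    tendsto_pi_nhds]
  intro i
  refine ((((tendsto_pi_nhds.1 hlap) i).add_const (∑ j, y j)).congr' ?_).trans_eq ?_
  · filter_upwards [hsum] with t ht
    rw [Function.comp_apply, commLapAddOnes_apply, ht]
  · rw [commLapAddOnes_apply]

end CommunicationLaplacian

section Network

theorem sum_mul_mulVec_B (x : Fin N → ℝ) (w : Fin M → ℝ) :
    ∑ i, x i * (G.B *ᵥ w) i = ∑ l, w l * (G.Bᵀ *ᵥ x) l := by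
  have h := Matrix.dotProduct_mulVec x G.B w
  rwa [← Matrix.mulVec_transpose, dotProduct_comm (G.Bᵀ *ᵥ x)] at h

theorem Le_mulVec (V : Fin N → ℝ) :
    G.Le *ᵥ V = G.B *ᵥ fun l => (G.Bᵀ *ᵥ V) l / G.R l := by
  rw [Le, ← Matrix.mulVec_mulVec, ← Matrix.mulVec_mulVec]
  congr 1
  ext l
  rw [Matrix.mulVec_diagonal, div_eq_inv_mul]

theorem LtMat_mulVec (x : Fin N → ℝ) (i : Fin N) :
    (G.LtMat *ᵥ x) i = G.Is i * x i - (∑ j, G.Is j)⁻¹ * (∑ j, G.Is j * x j) * G.Is i := by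
  rw [LtMat, Matrix.sub_mulVec, Matrix.smul_mulVec, Matrix.vecMulVec_mulVec]
  simp only [Pi.sub_apply, Pi.smul_apply, Matrix.mulVec_diagonal, dotProduct, smul_eq_mul,
    MulOpposite.smul_eq_mul_unop, MulOpposite.unop_op]
  ring

end Network

end Microgrid

/-! ### Equilibria -/

namespace State

variable {N M : ℕ}

/-- The projection of a closed-loop state to its components `(V, It, v, I)`. -/
def primary : State N M →L[ℝ] PrimaryState N M :=
  (ContinuousLinearMap.id ℝ _).prodMap ((ContinuousLinearMap.id ℝ _).prodMap
    ((ContinuousLinearMap.id ℝ _).prodMap (ContinuousLinearMap.fst ℝ _ _)))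

/-- `State.consensus` as a continuous linear map. -/
def consensusCLM : State N M →L[ℝ] (Fin N → ℝ) :=
  ((ContinuousLinearMap.snd ℝ _ _).comp (ContinuousLinearMap.snd ℝ _ _)).comp
    ((ContinuousLinearMap.snd ℝ _ _).comp (ContinuousLinearMap.snd ℝ _ _))

theorem ext_primary {X Y : State N M} (hprimary : primary X = primary Y)
    (hconsensus : X.consensus = Y.consensus) : X = Y := by
  obtain ⟨V, It, v, I, Ω⟩ := X
  obtain ⟨V', It', v', I', Ω'⟩ := Y
  simp_all [primary, consensus]

end State

namespace Microgrid

variable {N M : ℕ} {G : Microgrid N M} {K : Gains N}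

section Gains

theorem AdmissibleGains.alpha_neg (hK : G.AdmissibleGains K) (i : Fin N) : G.alpha K i < 0 :=
  div_neg_of_neg_of_pos (sub_neg.2 (hK.k₁_lt i)) (G.Lt_pos i)

theorem AdmissibleGains.beta_neg (hK : G.AdmissibleGains K) (i : Fin N) : G.beta K i < 0 :=
  div_neg_of_neg_of_pos (sub_neg.2 (hK.k₂_lt i)) (G.Lt_pos i)

theorem AdmissibleGains.gamma_pos (hK : G.AdmissibleGains K) (i : Fin N) : 0 < G.gamma K i :=
  div_pos (hK.k₃_pos i) (G.Lt_pos i)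

theorem AdmissibleGains.gamma_lt (hK : G.AdmissibleGains K) (i : Fin N) :
    G.gamma K i < G.alpha K i * G.beta K i := by
  calc G.gamma K i
      < 1 / G.Lt i * ((K.k₁ i - 1) * (K.k₂ i - G.Rt i)) / G.Lt i :=
        div_lt_div_of_pos_right (hK.k₃_lt i) (G.Lt_pos i)
    _ = G.alpha K i * G.beta K i := by rw [alpha, beta]; ring

theorem delta_eq_alpha (hk₄ : ∀ i, K.k₄ i = K.k₁ i - 1) : G.delta K = G.alpha K := by
  ext i
  rw [delta, alpha, hk₄]

end Gains

section Equilibria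

variable (G K)

/-- The effect of an output `ω` of the secondary layer on the primary-controlled system. -/
def secondaryInput (ω : Fin N → ℝ) : PrimaryState N M :=
  (0, fun i => G.delta K i * ω i, -ω, 0)

theorem primary_closedLoop (X : State N M) :
    State.primary (G.closedLoop K X)
      = G.primaryLoop K (State.primary X) + G.secondaryInput K (G.omega X.consensus) := by
  simp [State.primary, closedLoop, primaryLoop, secondaryInput, State.consensus, Pi.add_def,
    ← sub_eq_add_neg, Pi.sub_def]

theorem consensus_closedLoop (X : State N M) :
    (G.closedLoop K X).consensus = G.commLap fun i => X.2.1 i / G.Is i :=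
  rfl

theorem secondaryInput_zero : G.secondaryInput K 0 = 0 := by
  simp [secondaryInput, funext_iff]

/-- The line currents of an equilibrium with node voltages `V`. -/
def lineCurrent (V : Fin N → ℝ) (l : Fin M) : ℝ := (G.Bᵀ *ᵥ V) l / G.R l

/-- The filter currents of an equilibrium with node voltages `V`. -/
def filterCurrent (V : Fin N → ℝ) (i : Fin N) : ℝ :=
  G.loadCurrent V i + (G.B *ᵥ G.lineCurrent V) i

/-- The equilibrium of the primary-controlled system under the constant secondary output `ω`. -/
def primaryEquilibrium (ω : Fin N → ℝ) : PrimaryState N M :=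
  (G.Vref - ω, G.filterCurrent (G.Vref - ω),
    fun i => -(G.alpha K i * (G.Vref i - ω i) + G.beta K i * G.filterCurrent (G.Vref - ω) i
      + G.delta K i * ω i) / G.gamma K i,
    G.lineCurrent (G.Vref - ω))

variable {G K}

theorem primaryLoop_add_secondaryInput_eq_zero_iff (hK : G.AdmissibleGains K)
    {ω : Fin N → ℝ} {X : PrimaryState N M} :
    G.primaryLoop K X + G.secondaryInput K ω = 0 ↔ X = G.primaryEquilibrium K ω := by
  obtain ⟨V, It, v, I⟩ := X
  have voltage_iff : (fun i => G.Vref i - V i) + -ω = 0 ↔ V = G.Vref - ω := by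
    simp only [funext_iff, Pi.add_apply, Pi.neg_apply, Pi.zero_apply, Pi.sub_apply]
    exact forall_congr' fun i => ⟨fun h => by linarith, fun h => by linarith⟩
  have line_iff : (fun l => ((G.Bᵀ *ᵥ V) l - G.R l * I l) / G.L l) = 0
      ↔ I = G.lineCurrent V := by
    simp only [funext_iff, Pi.zero_apply, lineCurrent, div_eq_zero_iff, (G.L_pos _).ne',
      or_false, sub_eq_zero, eq_div_iff (G.R_pos _).ne', mul_comm (G.R _)]
    exact forall_congr' fun l => eq_comm
  have filter_iff (J : Fin M → ℝ) :
      (fun i => (It i - G.loadCurrent V i - (G.B *ᵥ J) i) / G.Ct i) = 0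
        ↔ It = fun i => G.loadCurrent V i + (G.B *ᵥ J) i := by
    simp only [funext_iff, Pi.zero_apply, div_eq_zero_iff, (G.Ct_pos _).ne', or_false,
      sub_sub, sub_eq_zero]
  have integrator_iff : ((fun i => G.alpha K i * V i + G.beta K i * It i + G.gamma K i * v i)
        + fun i => G.delta K i * ω i) = 0
      ↔ v = fun i => -(G.alpha K i * V i + G.beta K i * It i + G.delta K i * ω i)
        / G.gamma K i := by
    simp only [funext_iff, Pi.add_apply, Pi.zero_apply, eq_div_iff (hK.gamma_pos _).ne']
    exact forall_congr' fun i => ⟨fun h => by linarith, fun h => by linarith⟩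
  simp only [primaryLoop, secondaryInput, primaryEquilibrium, Prod.mk_add_mk, add_zero,
    Prod.mk_eq_zero, Prod.mk.injEq, voltage_iff, line_iff, filter_iff, integrator_iff]
  constructor <;>
  · rintro ⟨rfl, rfl, rfl, rfl⟩
    exact ⟨rfl, rfl, rfl, rfl⟩

theorem AdmissibleGains.existsUnique_primaryLoop_eq_zero (hK : G.AdmissibleGains K) :
    ∃! X : PrimaryState N M, G.primaryLoop K X = 0 := by
  have eq_zero_iff (X : PrimaryState N M) :
      G.primaryLoop K X = 0 ↔ X = G.primaryEquilibrium K 0 := by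
    rw [← primaryLoop_add_secondaryInput_eq_zero_iff hK, secondaryInput_zero, add_zero]
  exact ⟨_, (eq_zero_iff _).2 rfl, fun X => (eq_zero_iff X).1⟩

theorem fst_eq_Vref_of_primaryLoop_eq_zero {X : PrimaryState N M} (hX : G.primaryLoop K X = 0) :
    X.1 = G.Vref :=
  (sub_eq_zero.1 (congrArg (fun Y => Y.2.2.1) hX)).symm

theorem IsPositivePowerFlowSolution.exists_filterCurrent_eq_mul {V : Fin N → ℝ}
    (hV : G.IsPositivePowerFlowSolution V) : ∃ κ, ∀ i, G.filterCurrent V i = κ * G.Is i := by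
  refine ⟨(∑ j, G.Is j)⁻¹ * ∑ j, G.loadCurrent V j, fun i => ?_⟩
  have flow := congrFun hV.flow i
  rw [Le_mulVec, ← Matrix.mulVec_mulVec] at flow
  simp only [Pi.add_apply, Pi.zero_apply, LtMat_mulVec, Matrix.mulVec_diagonal,
    mul_inv_cancel_left₀ (G.Is_pos _).ne'] at flow
  rw [filterCurrent]
  unfold lineCurrent
  linarith

theorem IsPositivePowerFlowSolution.exists_omega_eq {V : Fin N → ℝ}
    (hV : G.IsPositivePowerFlowSolution V) : ∃ Ω, G.omega Ω = G.Vref - V := by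
  obtain ⟨Ω, hΩ⟩ := G.exists_commLap_eq (b := fun i => G.Is i * (G.Vref i - V i)) (by
    simp only [mul_sub, Finset.sum_sub_distrib, hV.balance, sub_self])
  refine ⟨Ω, ?_⟩
  ext i
  rw [omega, hΩ, inv_mul_cancel_left₀ (G.Is_pos i).ne', Pi.sub_apply]

theorem IsPositivePowerFlowSolution.exists_closedLoop_eq_zero {Vbar : Fin N → ℝ}
    (hV : G.IsPositivePowerFlowSolution Vbar) (hK : G.AdmissibleGains K) :
    ∃ Xbar : State N M, Xbar.voltage = Vbar ∧ G.closedLoop K Xbar = 0 := by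
  obtain ⟨κ, hκ⟩ := hV.exists_filterCurrent_eq_mul
  obtain ⟨Ω, hΩ⟩ := hV.exists_omega_eq
  obtain ⟨Y, hY⟩ : ∃ Y, Y = G.primaryEquilibrium K (G.omega Ω) := ⟨_, rfl⟩
  have voltage_eq : Y.1 = Vbar := by rw [hY, hΩ]; simp [primaryEquilibrium]
  have current_eq (i : Fin N) : Y.2.1 i = κ * G.Is i := by
    rw [hY, hΩ, ← hκ]
    simp [primaryEquilibrium]
  refine ⟨(Y.1, Y.2.1, Y.2.2.1, Y.2.2.2, Ω), voltage_eq, State.ext_primary ?_ ?_⟩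
  · rw [map_zero, primary_closedLoop]
    exact (primaryLoop_add_secondaryInput_eq_zero_iff hK).2 hY
  · rw [consensus_closedLoop]
    ext i
    simp [current_eq, commLap, (G.Is_pos _).ne', State.consensus]

end Equilibria

end Microgrid

/-! ### Incremental storage -/

namespace Microgrid

variable {N M : ℕ} (G : Microgrid N M) (K : Gains N)

section Storage

/-- The margin in the upper bound on the integrator gain, which normalizes the storage of the
primary controllers. -/
def gainMargin (i : Fin N) : ℝ := G.alpha K i * G.beta K i - G.gamma K i

/-- The part of the filter current dynamics that depends on the controller state `(It, v)`; these
are the combinations of controller states that are damped. -/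
def feedback (ξ : PrimaryState N M) (i : Fin N) : ℝ :=
  G.beta K i * ξ.2.1 i + G.gamma K i * ξ.2.2.1 i

/-- The bilinear form of the Lyapunov function of the primary-controlled system, with respect to
which this system is passive; see `Microgrid.storageForm_primaryLoop_sub`. -/
def storageForm : LinearMap.BilinForm ℝ (PrimaryState N M) :=
  let V (i : Fin N) : PrimaryState N M →ₗ[ℝ] ℝ := LinearMap.proj i ∘ₗ LinearMap.fst ℝ _ _
  let It (i : Fin N) : PrimaryState N M →ₗ[ℝ] ℝ :=
    LinearMap.proj i ∘ₗ LinearMap.fst ℝ _ _ ∘ₗ LinearMap.snd ℝ _ _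
  let v (i : Fin N) : PrimaryState N M →ₗ[ℝ] ℝ :=
    LinearMap.proj i ∘ₗ LinearMap.fst ℝ _ _ ∘ₗ LinearMap.snd ℝ _ _ ∘ₗ LinearMap.snd ℝ _ _
  let I (l : Fin M) : PrimaryState N M →ₗ[ℝ] ℝ :=
    LinearMap.proj l ∘ₗ LinearMap.snd ℝ _ _ ∘ₗ LinearMap.snd ℝ _ _ ∘ₗ LinearMap.snd ℝ _ _
  ∑ i, (G.Ct i • .linMulLin (V i) (V i)
      - (G.gainMargin K i)⁻¹ • (G.beta K i • .linMulLin (It i) (It i)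
        + G.gamma K i • (.linMulLin (It i) (v i) + .linMulLin (v i) (It i))
        + (G.alpha K i * G.gamma K i) • .linMulLin (v i) (v i)))
    + ∑ l, G.L l • .linMulLin (I l) (I l)

theorem storageForm_apply (ξ η : PrimaryState N M) :
    G.storageForm K ξ η
      = ∑ i, (G.Ct i * (ξ.1 i * η.1 i)
          - (G.gainMargin K i)⁻¹ * (G.beta K i * (ξ.2.1 i * η.2.1 i)
            + G.gamma K i * (ξ.2.1 i * η.2.2.1 i + ξ.2.2.1 i * η.2.1 i)
            + G.alpha K i * G.gamma K i * (ξ.2.2.1 i * η.2.2.1 i)))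
        + ∑ l, G.L l * (ξ.2.2.2 l * η.2.2.2 l) := by
  simp [storageForm, mul_add]

theorem isSymm_storageForm : (G.storageForm K).IsSymm := by
  refine ⟨fun ξ η => ?_⟩
  simp only [storageForm_apply]
  congr 1 <;> exact Finset.sum_congr rfl fun _ _ => by ring

/-- The rate at which the storage of the difference of two solutions of the primary-controlled
system decreases. -/
def dissipation (Y X : PrimaryState N M) : ℝ :=
  ∑ i, ((X.1 i - Y.1 i) * (G.loadCurrent X.1 i - G.loadCurrent Y.1 i)
      + (G.gainMargin K i)⁻¹ * G.feedback K (X - Y) i ^ 2)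
    + ∑ l, G.R l * (X.2.2.2 l - Y.2.2.2 l) ^ 2

variable {G K}

theorem AdmissibleGains.gainMargin_pos (hK : G.AdmissibleGains K) (i : Fin N) :
    0 < G.gainMargin K i :=
  sub_pos.2 (hK.gamma_lt i)

-- Completing the square in the filter current error.
theorem AdmissibleGains.storageForm_self (hK : G.AdmissibleGains K) (ξ : PrimaryState N M) :
    G.storageForm K ξ ξ
      = ∑ i, (G.Ct i * ξ.1 i ^ 2
          + ((-G.beta K i * G.gainMargin K i)⁻¹ * G.feedback K ξ i ^ 2
            + G.gamma K i / -G.beta K i * ξ.2.2.1 i ^ 2))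
        + ∑ l, G.L l * ξ.2.2.2 l ^ 2 := by
  rw [storageForm_apply]
  congr 1 <;> refine Finset.sum_congr rfl fun i _ => ?_
  · have margin_ne := (hK.gainMargin_pos i).ne'
    have beta_ne := (hK.beta_neg i).ne
    simp only [feedback]
    field_simp
    rw [gainMargin]
    ring
  · ring

theorem AdmissibleGains.storageForm_self_pos (hK : G.AdmissibleGains K) (ξ : PrimaryState N M)
    (hξ : ξ ≠ 0) : 0 < G.storageForm K ξ ξ := by
  have feedback_coeff_pos (i) : 0 < (-G.beta K i * G.gainMargin K i)⁻¹ :=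
    inv_pos.2 (mul_pos (neg_pos.2 (hK.beta_neg i)) (hK.gainMargin_pos i))
  have integrator_coeff_pos (i) : 0 < G.gamma K i / -G.beta K i :=
    div_pos (hK.gamma_pos i) (neg_pos.2 (hK.beta_neg i))
  have voltage_nonneg (i) := mul_nonneg (G.Ct_pos i).le (sq_nonneg (ξ.1 i))
  have feedback_nonneg (i) := mul_nonneg (feedback_coeff_pos i).le (sq_nonneg (G.feedback K ξ i))
  have integrator_nonneg (i) := mul_nonneg (integrator_coeff_pos i).le (sq_nonneg (ξ.2.2.1 i))
  have node_nonneg (i) := add_nonneg (voltage_nonneg i)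
    (add_nonneg (feedback_nonneg i) (integrator_nonneg i))
  have line_nonneg (l) := mul_nonneg (G.L_pos l).le (sq_nonneg (ξ.2.2.2 l))
  have nodes_nonneg := Finset.sum_nonneg fun i (_ : i ∈ Finset.univ) => node_nonneg i
  have lines_nonneg := Finset.sum_nonneg fun l (_ : l ∈ Finset.univ) => line_nonneg l
  rw [hK.storageForm_self]
  refine (add_nonneg nodes_nonneg lines_nonneg).lt_of_ne' fun hzero => hξ ?_
  simp only [add_eq_zero_iff_of_nonneg nodes_nonneg lines_nonneg,
    Finset.sum_eq_zero_iff_of_nonneg fun i _ => node_nonneg i,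
    Finset.sum_eq_zero_iff_of_nonneg fun l _ => line_nonneg l, Finset.mem_univ, true_imp_iff,
    add_eq_zero_iff_of_nonneg (voltage_nonneg _)
      (add_nonneg (feedback_nonneg _) (integrator_nonneg _)),
    add_eq_zero_iff_of_nonneg (feedback_nonneg _) (integrator_nonneg _), mul_eq_zero,
    (G.Ct_pos _).ne', (G.L_pos _).ne', (feedback_coeff_pos _).ne', (integrator_coeff_pos _).ne',
    false_or, sq_eq_zero_iff] at hzero
  obtain ⟨hnode, hline⟩ := hzero
  have current_eq_zero (i) : ξ.2.1 i = 0 := by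
    simpa [feedback, (hnode i).2.2, (hK.beta_neg i).ne] using (hnode i).2.1
  exact Prod.ext (funext fun i => (hnode i).1) (Prod.ext (funext current_eq_zero)
    (Prod.ext (funext fun i => (hnode i).2.2) (funext hline)))

-- The weights of the storage are chosen to produce the power `y * x` exchanged with the network.
theorem AdmissibleGains.controller_power_eq (hK : G.AdmissibleGains K) (i : Fin N)
    (x y z f : ℝ) :
    (G.gainMargin K i)⁻¹
        * (G.beta K i * (y * (G.alpha K i * x + f))
          + G.gamma K i * (y * -x + z * (G.alpha K i * x + f))
          + G.alpha K i * G.gamma K i * (z * -x))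
      = y * x + (G.gainMargin K i)⁻¹ * ((G.beta K i * y + G.gamma K i * z) * f) := by
  have margin_ne := (hK.gainMargin_pos i).ne'
  field_simp
  rw [gainMargin]
  ring

theorem AdmissibleGains.storageForm_secondaryInput (hK : G.AdmissibleGains K)
    (hk₄ : ∀ i, K.k₄ i = K.k₁ i - 1) (ξ : PrimaryState N M) (ω : Fin N → ℝ) :
    G.storageForm K ξ (G.secondaryInput K ω) = -∑ i, ξ.2.1 i * ω i := by
  have controller_power (i : Fin N) := hK.controller_power_eq i (ω i) (ξ.2.1 i) (ξ.2.2.1 i) 0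
  simp only [add_zero, mul_zero] at controller_power
  simp [storageForm_apply, secondaryInput, delta_eq_alpha hk₄, -mul_neg, controller_power]

theorem AdmissibleGains.storageForm_primaryLoop_sub (hK : G.AdmissibleGains K)
    (X Y : PrimaryState N M) :
    G.storageForm K (X - Y) (G.primaryLoop K X - G.primaryLoop K Y) = -G.dissipation K Y X := by
  obtain ⟨V, It, v, I⟩ := X
  obtain ⟨V', It', v', I'⟩ := Y
  have network_cancel := G.sum_mul_mulVec_B (V - V') (I - I')
  have filter_power (i : Fin N) :
      G.Ct i * ((V i - V' i) * ((It i - G.loadCurrent V i - (G.B *ᵥ I) i) / G.Ct i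
        - (It' i - G.loadCurrent V' i - (G.B *ᵥ I') i) / G.Ct i))
      = (It i - It' i) * (V i - V' i) - (V i - V' i) * (G.loadCurrent V i - G.loadCurrent V' i)
        - (V i - V' i) * (G.B *ᵥ (I - I')) i := by
    have := (G.Ct_pos i).ne'
    rw [Matrix.mulVec_sub, Pi.sub_apply]
    field_simp
    ring
  have line_power (l : Fin M) :
      G.L l * ((I l - I' l) * (((G.Bᵀ *ᵥ V) l - G.R l * I l) / G.L l
        - ((G.Bᵀ *ᵥ V') l - G.R l * I' l) / G.L l))
      = (I l - I' l) * (G.Bᵀ *ᵥ (V - V')) l - G.R l * (I l - I' l) ^ 2 := by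
    have := (G.L_pos l).ne'
    rw [Matrix.mulVec_sub, Pi.sub_apply]
    field_simp
    ring
  have feedback_sub (i : Fin N) :
      G.alpha K i * V i + G.beta K i * It i + G.gamma K i * v i
        - (G.alpha K i * V' i + G.beta K i * It' i + G.gamma K i * v' i)
      = G.alpha K i * (V i - V' i)
        + (G.beta K i * (It i - It' i) + G.gamma K i * (v i - v' i)) := by ring
  have integrator_sub (i : Fin N) : G.Vref i - V i - (G.Vref i - V' i) = -(V i - V' i) := by ring
  simp only [storageForm_apply, primaryLoop, dissipation, feedback, Prod.mk_sub_mk, Pi.sub_apply,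
    feedback_sub, integrator_sub, filter_power, line_power, hK.controller_power_eq, ← sq,
    Finset.sum_sub_distrib, Finset.sum_add_distrib] at network_cancel ⊢
  linarith

end Storage

end Microgrid

namespace Microgrid

open Metric

variable {N M : ℕ} {G : Microgrid N M} {K : Gains N}

section ClosedLoopStorage

theorem secondaryInput_sub (ω ω' : Fin N → ℝ) :
    G.secondaryInput K (ω - ω') = G.secondaryInput K ω - G.secondaryInput K ω' :=
  Prod.ext (sub_self 0).symm (Prod.ext (funext fun _ => mul_sub _ _ _)
    (Prod.ext (neg_sub' ω ω') (sub_self 0).symm))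

theorem sum_mul_omega_sub (x Ω Ω' : Fin N → ℝ) :
    ∑ i, x i * (G.omega Ω - G.omega Ω') i
      = ∑ i, (Ω - Ω') i * G.commLap (fun j => x j / G.Is j) i := by
  rw [sum_mul_commLap_comm, commLap_sub]
  refine Finset.sum_congr rfl fun i _ => ?_
  simp only [omega, Pi.sub_apply]
  ring

variable (G K)

/-- The bilinear form of the Lyapunov function of the closed-loop system: the storage of the
primary-controlled system plus the inner product of the consensus variables. -/
def closedStorageForm : LinearMap.BilinForm ℝ (State N M) :=
  (G.storageForm K).compl₁₂ State.primary.toLinearMap State.primary.toLinearMap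
    + (dotProductBilin ℝ ℝ).compl₁₂ State.consensusCLM.toLinearMap State.consensusCLM.toLinearMap

theorem closedStorageForm_apply (ξ η : State N M) :
    G.closedStorageForm K ξ η
      = G.storageForm K (State.primary ξ) (State.primary η) + ξ.consensus ⬝ᵥ η.consensus :=
  rfl

theorem isSymm_closedStorageForm : (G.closedStorageForm K).IsSymm :=
  ⟨fun ξ η => by
    simp only [closedStorageForm_apply, dotProduct_comm ξ.consensus,
      (G.isSymm_storageForm K).eq (State.primary ξ)]⟩

variable {G K}

theorem AdmissibleGains.closedStorageForm_self_pos (hK : G.AdmissibleGains K) (ξ : State N M)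
    (hξ : ξ ≠ 0) : 0 < G.closedStorageForm K ξ ξ := by
  have consensus_nonneg : 0 ≤ ξ.consensus ⬝ᵥ ξ.consensus :=
    Finset.sum_nonneg fun i _ => mul_self_nonneg _
  rw [closedStorageForm_apply]
  by_cases hprimary : State.primary ξ = 0
  · refine add_pos_of_nonneg_of_pos (by simp [hprimary]) (consensus_nonneg.lt_of_ne' fun h => ?_)
    exact hξ (State.ext_primary (hprimary.trans (map_zero _).symm) (dotProduct_self_eq_zero.1 h))
  · exact add_pos_of_pos_of_nonneg (hK.storageForm_self_pos _ hprimary) consensus_nonneg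

-- The secondary layer exchanges no net power: it is a lossless feedback of the passive output `It`.
theorem AdmissibleGains.closedStorageForm_closedLoop_sub (hK : G.AdmissibleGains K)
    (hk₄ : ∀ i, K.k₄ i = K.k₁ i - 1) (X Y : State N M) :
    G.closedStorageForm K (X - Y) (G.closedLoop K X - G.closedLoop K Y)
      = -G.dissipation K (State.primary Y) (State.primary X) := by
  have consensus_power :
      (X - Y).consensus ⬝ᵥ (G.closedLoop K X - G.closedLoop K Y).consensus
        = ∑ i, (X - Y).2.1 i * (G.omega X.consensus - G.omega Y.consensus) i := by
    rw [sum_mul_omega_sub]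
    change ∑ i, (X.consensus - Y.consensus) i * ((G.closedLoop K X).consensus
      - (G.closedLoop K Y).consensus) i = _
    simp only [consensus_closedLoop, ← commLap_sub]
    simp only [Pi.sub_def, Prod.fst_sub, Prod.snd_sub, sub_div]
  rw [closedStorageForm_apply, consensus_power, map_sub State.primary, map_sub State.primary,
    primary_closedLoop, primary_closedLoop, add_sub_add_comm, ← secondaryInput_sub, map_add,
    hK.storageForm_primaryLoop_sub, hK.storageForm_secondaryInput hk₄]
  exact neg_add_cancel_right _ _

theorem AdmissibleGains.storageForm_primaryLoop (hK : G.AdmissibleGains K)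
    {Xbar : PrimaryState N M} (hXbar : G.primaryLoop K Xbar = 0) (X : PrimaryState N M) :
    G.storageForm K (X - Xbar) (G.primaryLoop K X) = -G.dissipation K Xbar X := by
  rw [← hK.storageForm_primaryLoop_sub, hXbar, sub_zero]

theorem AdmissibleGains.closedStorageForm_closedLoop (hK : G.AdmissibleGains K)
    (hk₄ : ∀ i, K.k₄ i = K.k₁ i - 1) {Xbar : State N M} (hXbar : G.closedLoop K Xbar = 0)
    (X : State N M) :
    G.closedStorageForm K (X - Xbar) (G.closedLoop K X)
      = -G.dissipation K (State.primary Xbar) (State.primary X) := by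
  rw [← hK.closedStorageForm_closedLoop_sub hk₄, hXbar, sub_zero]

end ClosedLoopStorage

section RegularLoads

variable (G) in
/-- Within distance `ρ` of `Vbar`, the load currents are continuously differentiable and the load
current of node `i` grows from its value at `Vbar` at least with slope `c i`. -/
structure IsRegularLoad (Vbar c : Fin N → ℝ) (ρ : ℝ) : Prop where
  pos : ∀ i, 0 < c i
  mul_sq_le : ∀ V ∈ closedBall Vbar ρ, ∀ i, c i * (V i - Vbar i) ^ 2
    ≤ (V i - Vbar i) * (G.loadCurrent V i - G.loadCurrent Vbar i)
  contDiffAt : ∀ V ∈ closedBall Vbar ρ, ContDiffAt ℝ 1 G.loadCurrent V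

theorem LoadCondition.slope_pos {V : Fin N → ℝ} (hload : G.LoadCondition V) (hV : ∀ i, 0 < V i)
    (hP : ∀ i, 1 < G.r i → 0 ≤ G.PL i) (i : Fin N) :
    0 < G.YL i + (G.r i - 1) * V i ^ (G.r i - 1 - 1) * G.PL i := by
  rcases lt_or_ge (G.r i) 1 with hr | hr
  · have power_eq : G.ePower V i = V i ^ (G.r i - 1 - 1) * G.PL i * V i ^ 2 := by
      rw [ePower, mul_right_comm, ← Real.rpow_natCast (V i) 2, ← Real.rpow_add (hV i), mul_comm,
        sub_sub, Nat.cast_ofNat, one_add_one_eq_two, sub_add_cancel]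
    have hcond := hload i hr
    rw [power_eq, ← mul_assoc, mul_lt_mul_iff_left₀ (pow_pos (hV i) 2)] at hcond
    linarith
  · have power_slope_nonneg : 0 ≤ (G.r i - 1) * V i ^ (G.r i - 1 - 1) * G.PL i := by
      rcases hr.eq_or_lt with hr | hr
      · simp [← hr]
      · exact mul_nonneg (mul_nonneg (sub_nonneg.2 hr.le) (Real.rpow_nonneg (hV i).le _))
          (hP i hr)
    exact add_pos_of_pos_of_nonneg (G.YL_pos i) power_slope_nonneg

theorem contDiffAt_loadCurrent {V : Fin N → ℝ} (hV : ∀ i, 0 < V i) :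
    ContDiffAt ℝ 1 G.loadCurrent V := by
  refine contDiffAt_pi.2 fun i => ?_
  have hcoord : ContDiffAt ℝ 1 (fun U : Fin N → ℝ => U i) V := contDiffAt_apply ..
  exact ((contDiffAt_const.mul hcoord).add contDiffAt_const).add
    ((hcoord.rpow_const_of_ne (hV i).ne').mul contDiffAt_const)

theorem eventually_mul_sq_le_loadCurrent {V c : Fin N → ℝ} (hV : ∀ i, 0 < V i) {i : Fin N}
    (hc : c i < G.YL i + (G.r i - 1) * V i ^ (G.r i - 1 - 1) * G.PL i) :
    ∀ᶠ U in 𝓝 V, c i * (U i - V i) ^ 2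
      ≤ (U i - V i) * (G.loadCurrent U i - G.loadCurrent V i) := by
  have hder : HasDerivAt (fun v : ℝ => G.YL i * v + G.IL i + v ^ (G.r i - 1) * G.PL i)
      (G.YL i + (G.r i - 1) * V i ^ (G.r i - 1 - 1) * G.PL i) (V i) := by
    simpa using (((hasDerivAt_id (V i)).const_mul (G.YL i)).add_const (G.IL i)).fun_add
      ((Real.hasDerivAt_rpow_const (p := G.r i - 1) (Or.inl (hV i).ne')).mul_const (G.PL i))
  exact ((continuous_apply i).tendsto V).eventually (eventually_mul_sq_le_of_hasDerivAt hc hder)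

theorem LoadCondition.exists_isRegularLoad {V : Fin N → ℝ} (hload : G.LoadCondition V)
    (hV : ∀ i, 0 < V i) (hP : ∀ i, 1 < G.r i → 0 ≤ G.PL i) :
    ∃ c, ∃ ρ > 0, G.IsRegularLoad V c ρ := by
  choose c hc_pos hc_lt using fun i => exists_between (hload.slope_pos hV hP i)
  have hpos : ∀ᶠ U in 𝓝 V, ∀ i, 0 < U i := Filter.eventually_all.2 fun i =>
    ((continuous_apply i).tendsto V).eventually_const_lt (hV i)
  have hslope := Filter.eventually_all.2 fun i => eventually_mul_sq_le_loadCurrent hV (hc_lt i)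
  obtain ⟨ρ, hρ, hball⟩ := nhds_basis_closedBall.eventually_iff.1 (hpos.and hslope)
  exact ⟨c, ρ, hρ, hc_pos, fun U hU => (hball hU).2,
    fun U hU => contDiffAt_loadCurrent (hball hU).1⟩

theorem isRegularLoad_YL (hPL : ∀ i, G.PL i = 0) (V : Fin N → ℝ) (ρ : ℝ) :
    G.IsRegularLoad V G.YL ρ := by
  have hlinear : G.loadCurrent = fun U i => G.YL i * U i + G.IL i := by
    ext U i
    simp [loadCurrent, hPL]
  refine ⟨G.YL_pos, fun U _ i => ?_, fun U _ => ?_⟩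
  · rw [hlinear]
    exact le_of_eq (by ring)
  · rw [hlinear]
    fun_prop

end RegularLoads

section Dissipation

variable {Y X : PrimaryState N M} {c : Fin N → ℝ} {ρ : ℝ}

theorem IsRegularLoad.sum_le_dissipation (hreg : G.IsRegularLoad Y.1 c ρ)
    (hX : X.1 ∈ closedBall Y.1 ρ) :
    ∑ i, (c i * (X.1 i - Y.1 i) ^ 2 + (G.gainMargin K i)⁻¹ * G.feedback K (X - Y) i ^ 2)
      + ∑ l, G.R l * (X.2.2.2 l - Y.2.2.2 l) ^ 2 ≤ G.dissipation K Y X := by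
  refine add_le_add_left (Finset.sum_le_sum fun i _ => ?_) _
  exact add_le_add_left (hreg.mul_sq_le X.1 hX i) _

theorem IsRegularLoad.le_dissipation (hreg : G.IsRegularLoad Y.1 c ρ)
    (hK : G.AdmissibleGains K) (hX : X.1 ∈ closedBall Y.1 ρ) :
    0 ≤ G.dissipation K Y X ∧
    (∀ i, c i * (X.1 i - Y.1 i) ^ 2 ≤ G.dissipation K Y X) ∧
    (∀ i, (G.gainMargin K i)⁻¹ * G.feedback K (X - Y) i ^ 2 ≤ G.dissipation K Y X) ∧
    ∀ l, G.R l * (X.2.2.2 l - Y.2.2.2 l) ^ 2 ≤ G.dissipation K Y X := by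
  have voltage_nonneg (i) : 0 ≤ c i * (X.1 i - Y.1 i) ^ 2 :=
    mul_nonneg (hreg.pos i).le (sq_nonneg _)
  have feedback_nonneg (i) : 0 ≤ (G.gainMargin K i)⁻¹ * G.feedback K (X - Y) i ^ 2 :=
    mul_nonneg (inv_nonneg.2 (hK.gainMargin_pos i).le) (sq_nonneg _)
  have node_nonneg (i) := add_nonneg (voltage_nonneg i) (feedback_nonneg i)
  have line_nonneg (l) : 0 ≤ G.R l * (X.2.2.2 l - Y.2.2.2 l) ^ 2 :=
    mul_nonneg (G.R_pos l).le (sq_nonneg _)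
  have nodes_nonneg := Finset.sum_nonneg fun i (_ : i ∈ Finset.univ) => node_nonneg i
  have lines_nonneg := Finset.sum_nonneg fun l (_ : l ∈ Finset.univ) => line_nonneg l
  have node_le (i) := Finset.single_le_sum (fun j _ => node_nonneg j) (Finset.mem_univ i)
  have line_le (l) := Finset.single_le_sum (fun j _ => line_nonneg j) (Finset.mem_univ l)
  have total_le := hreg.sum_le_dissipation (K := K) hX
  refine ⟨by linarith, fun i => ?_, fun i => ?_, fun l => ?_⟩
  · linarith [node_le i, feedback_nonneg i]
  · linarith [node_le i, voltage_nonneg i]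
  · linarith [line_le l]

end Dissipation

section VectorFields

theorem contDiffAt_primaryLoop {X : PrimaryState N M} (hX : ContDiffAt ℝ 1 G.loadCurrent X.1) :
    ContDiffAt ℝ 1 (G.primaryLoop K) X := by
  have hload (i) : ContDiffAt ℝ 1 (fun Y : PrimaryState N M => G.loadCurrent Y.1 i) X :=
    contDiffAt_pi.1 (hX.comp X contDiffAt_fst) i
  unfold primaryLoop Matrix.mulVec dotProduct
  fun_prop

theorem contDiffAt_closedLoop {X : State N M} (hX : ContDiffAt ℝ 1 G.loadCurrent X.voltage) :
    ContDiffAt ℝ 1 (G.closedLoop K) X := by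
  have hload (i) : ContDiffAt ℝ 1 (fun Y : State N M => G.loadCurrent Y.1 i) X :=
    contDiffAt_pi.1 (hX.comp X contDiffAt_fst) i
  unfold closedLoop omega commLap Matrix.mulVec dotProduct
  fun_prop

end VectorFields

section LyapunovFunctions

open ODEStability

theorem AdmissibleGains.exists_isLyapunovFunctionOn_primaryLoop (hK : G.AdmissibleGains K)
    {Xbar : PrimaryState N M} (hXbar : G.primaryLoop K Xbar = 0) :
    ∃ κ > 0, ∀ c ρ, G.IsRegularLoad Xbar.1 c ρ → IsLyapunovFunctionOn (G.primaryLoop K)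
      (quadraticStorage (G.storageForm K) Xbar) Xbar κ ρ := by
  obtain ⟨κ, hκ, hlyap⟩ := exists_isLyapunovFunctionOn_quadraticStorage
    (G.isSymm_storageForm K) hK.storageForm_self_pos Xbar
  refine ⟨κ, hκ, fun c ρ hreg => hlyap _ ρ fun X hX => ?_⟩
  rw [hK.storageForm_primaryLoop hXbar, neg_nonpos]
  exact (hreg.le_dissipation hK (fst_mem_closedBall hX)).1

theorem AdmissibleGains.exists_isLyapunovFunctionOn_closedLoop (hK : G.AdmissibleGains K)
    (hk₄ : ∀ i, K.k₄ i = K.k₁ i - 1) {Xbar : State N M} (hXbar : G.closedLoop K Xbar = 0) :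
    ∃ κ > 0, ∀ c ρ, G.IsRegularLoad Xbar.voltage c ρ → IsLyapunovFunctionOn (G.closedLoop K)
      (quadraticStorage (G.closedStorageForm K) Xbar) Xbar κ ρ := by
  obtain ⟨κ, hκ, hlyap⟩ := exists_isLyapunovFunctionOn_quadraticStorage
    (G.isSymm_closedStorageForm K) hK.closedStorageForm_self_pos Xbar
  refine ⟨κ, hκ, fun c ρ hreg => hlyap _ ρ fun X hX => ?_⟩
  rw [hK.closedStorageForm_closedLoop hk₄ hXbar, neg_nonpos]
  exact (hreg.le_dissipation (Y := State.primary Xbar) (X := State.primary X) hK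
    (fst_mem_closedBall (x := X) hX)).1

end LyapunovFunctions

end Microgrid

/-! ### Convergence of solutions -/

namespace State

variable {N M : ℕ}

theorem sum_consensus_shiftTo (hN : (N : ℝ) ≠ 0) (Xbar X₀ : State N M) :
    ∑ i, (Xbar.shiftTo X₀).consensus i = ∑ i, X₀.consensus i := by
  simp [shiftTo, consensus, Finset.sum_add_distrib, mul_div_cancel₀ _ hN]

theorem shiftTo_eq_self {Xbar X₀ : State N M} (h : X₀ ∈ Xbar.leaf) : Xbar.shiftTo X₀ = Xbar := by
  have shift_eq_zero : ∑ i, (X₀.consensus i - Xbar.consensus i) = 0 := by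
    rw [Finset.sum_sub_distrib, sub_eq_zero]
    exact h
  refine ext_primary rfl (funext fun i => ?_)
  simp only [shiftTo, shift_eq_zero, zero_div, add_zero]
  rfl

theorem tendsto_of_primary_of_consensus {ι : Type*} {F : Filter ι} {X : ι → State N M}
    {Y : State N M} (hprimary : Filter.Tendsto (fun t => primary (X t)) F (𝓝 (primary Y)))
    (hconsensus : Filter.Tendsto (fun t => (X t).consensus) F (𝓝 Y.consensus)) :
    Filter.Tendsto X F (𝓝 Y) :=
  (hprimary.fst_nhds).prodMk_nhds (hprimary.snd_nhds.fst_nhds.prodMk_nhds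
    (hprimary.snd_nhds.snd_nhds.fst_nhds.prodMk_nhds
      (hprimary.snd_nhds.snd_nhds.snd_nhds.prodMk_nhds hconsensus)))

end State

namespace Microgrid

open Filter Metric Set

variable {N M : ℕ} {G : Microgrid N M} {K : Gains N}

section PrimaryConvergence

variable {ι : Type*} {F : Filter ι} {X : ι → PrimaryState N M} {Y : PrimaryState N M}
  {c : Fin N → ℝ} {ρ : ℝ}

theorem IsRegularLoad.tendsto_of_tendsto_dissipation (hreg : G.IsRegularLoad Y.1 c ρ)
    (hK : G.AdmissibleGains K) (hball : ∀ᶠ t in F, (X t).1 ∈ closedBall Y.1 ρ)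
    (hD : Tendsto (fun t => G.dissipation K Y (X t)) F (𝓝 0)) :
    Tendsto (fun t => (X t).1) F (𝓝 Y.1) ∧
    (∀ i, Tendsto (fun t => G.feedback K (X t - Y) i) F (𝓝 0)) ∧
    Tendsto (fun t => (X t).2.2.2) F (𝓝 Y.2.2.2) := by
  have hle := hball.mono fun t ht => hreg.le_dissipation hK ht
  refine ⟨tendsto_pi_nhds.2 fun i => ?_, fun i => ?_, tendsto_pi_nhds.2 fun l => ?_⟩
  · exact tendsto_sub_nhds_zero_iff.1
      (tendsto_zero_of_mul_sq_le (hreg.pos i) (hle.mono fun t ht => ht.2.1 i) hD)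
  · exact tendsto_zero_of_mul_sq_le (inv_pos.2 (hK.gainMargin_pos i))
      (hle.mono fun t ht => ht.2.2.1 i) hD
  · exact tendsto_sub_nhds_zero_iff.1
      (tendsto_zero_of_mul_sq_le (G.R_pos l) (hle.mono fun t ht => ht.2.2.2 l) hD)

theorem It_eq_of_primaryLoop (X : PrimaryState N M) :
    X.2.1 = G.Ct * (G.primaryLoop K X).1 + G.loadCurrent X.1 + G.B *ᵥ X.2.2.2 := by
  ext i
  have := (G.Ct_pos i).ne'
  simp only [primaryLoop, Pi.add_apply, Pi.mul_apply]
  field_simp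
  ring

theorem tendsto_It (hY : (G.primaryLoop K Y).1 = 0)
    (hload : ContinuousAt G.loadCurrent Y.1) (hV : Tendsto (fun t => (X t).1) F (𝓝 Y.1))
    (hI : Tendsto (fun t => (X t).2.2.2) F (𝓝 Y.2.2.2))
    (hrate : Tendsto (fun t => (G.primaryLoop K (X t)).1) F (𝓝 0)) :
    Tendsto (fun t => (X t).2.1) F (𝓝 Y.2.1) := by
  have hB : Continuous fun w : Fin M → ℝ => G.B *ᵥ w := by fun_prop
  simp only [It_eq_of_primaryLoop (G := G) (K := K) (X _)]
  rw [It_eq_of_primaryLoop (G := G) (K := K) Y, hY]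
  exact ((hrate.const_mul G.Ct).add (hload.tendsto.comp hV)).add ((hB.tendsto _).comp hI)

theorem AdmissibleGains.tendsto_v (hK : G.AdmissibleGains K)
    (hIt : Tendsto (fun t => (X t).2.1) F (𝓝 Y.2.1))
    (hfeedback : ∀ i, Tendsto (fun t => G.feedback K (X t - Y) i) F (𝓝 0)) :
    Tendsto (fun t => (X t).2.2.1) F (𝓝 Y.2.2.1) := by
  refine tendsto_pi_nhds.2 fun i => ?_
  have hcurrent := tendsto_sub_nhds_zero_iff.2 (tendsto_pi_nhds.1 hIt i)
  have hdiff := ((hfeedback i).sub (hcurrent.const_mul (G.beta K i))).const_mul (G.gamma K i)⁻¹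
  rw [mul_zero, sub_zero, mul_zero] at hdiff
  refine tendsto_sub_nhds_zero_iff.1 (hdiff.congr fun t => ?_)
  have := (hK.gamma_pos i).ne'
  simp only [feedback, Prod.fst_sub, Prod.snd_sub, Pi.sub_apply]
  field_simp
  ring

theorem IsRegularLoad.tendsto_primary (hreg : G.IsRegularLoad Y.1 c ρ) (hρ : 0 ≤ ρ)
    (hK : G.AdmissibleGains K) (hY : (G.primaryLoop K Y).1 = 0)
    (hball : ∀ᶠ t in F, (X t).1 ∈ closedBall Y.1 ρ)
    (hD : Tendsto (fun t => G.dissipation K Y (X t)) F (𝓝 0))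
    (hrate : Tendsto (fun t => (X t).1) F (𝓝 Y.1) →
      Tendsto (fun t => (G.primaryLoop K (X t)).1) F (𝓝 0)) :
    Tendsto X F (𝓝 Y) := by
  obtain ⟨hV, hfeedback, hI⟩ := hreg.tendsto_of_tendsto_dissipation hK hball hD
  have hload := (hreg.contDiffAt Y.1 (mem_closedBall_self hρ)).continuousAt
  have hIt := tendsto_It hY hload hV hI (hrate hV)
  exact hV.prodMk_nhds (hIt.prodMk_nhds ((hK.tendsto_v hIt hfeedback).prodMk_nhds hI))

end PrimaryConvergence

section ConservedSum

theorem sum_consensus_eq {s : Set ℝ} (hs : Convex ℝ s) (h0 : (0 : ℝ) ∈ s) {X : ℝ → State N M}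
    (hX : IsIntegralCurveOn X (fun _ => G.closedLoop K) s) {t : ℝ} (ht : t ∈ s) :
    ∑ i, (X t).consensus i = ∑ i, (X 0).consensus i := by
  have hder (τ) (hτ : τ ∈ s) : HasDerivWithinAt (fun τ => ∑ i, (X τ).consensus i) 0 s τ := by
    rw [← G.sum_commLap fun i => (X τ).2.1 i / G.Is i]
    exact HasDerivWithinAt.fun_sum fun i _ =>
      hasDerivWithinAt_pi.1 (State.consensusCLM.hasFDerivAt.comp_hasDerivWithinAt τ (hX τ hτ)) i
  have hconst := hs.norm_image_sub_le_of_norm_hasDerivWithin_le hder (C := 0) (by simp) h0 ht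
  rwa [zero_mul, norm_le_zero_iff, sub_eq_zero] at hconst

theorem isForwardInvariant_leaf (Xbar : State N M) :
    ODEStability.IsForwardInvariant (G.closedLoop K) Xbar.leaf := fun T _ hT hX h0 _ ht =>
  (sum_consensus_eq (convex_Ico 0 T) (left_mem_Ico.2 hT) hX ht).trans h0

end ConservedSum

section ClosedLoopConvergence

variable {Xbar : State N M} {c : Fin N → ℝ} {ρ κ : ℝ} {X : ℝ → State N M}

theorem AdmissibleGains.commLap_consensus_eq (hK : G.AdmissibleGains K)
    (hk₄ : ∀ i, K.k₄ i = K.k₁ i - 1) (X : State N M) (i : Fin N) :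
    G.commLap X.consensus i = G.Is i * ((G.alpha K i)⁻¹ * ((G.closedLoop K X).2.1 i
      - (G.alpha K i * X.1 i + G.beta K i * X.2.1 i + G.gamma K i * X.2.2.1 i))) := by
  have alpha_ne := (hK.alpha_neg i).ne
  have Is_ne := (G.Is_pos i).ne'
  simp only [closedLoop, delta_eq_alpha hk₄, omega, State.consensus]
  field_simp
  ring

theorem AdmissibleGains.tendsto_commLap_consensus (hK : G.AdmissibleGains K)
    (hk₄ : ∀ i, K.k₄ i = K.k₁ i - 1) (hXbar : G.closedLoop K Xbar = 0) {F : Filter ℝ}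
    (hprimary : Tendsto (fun t => State.primary (X t)) F (𝓝 (State.primary Xbar)))
    (hrate : Tendsto (fun t => (G.closedLoop K (X t)).2.1) F (𝓝 0)) :
    Tendsto (fun t => G.commLap (X t).consensus) F (𝓝 (G.commLap Xbar.consensus)) := by
  refine tendsto_pi_nhds.2 fun i => ?_
  have hfeedback : Continuous fun Y : PrimaryState N M =>
      G.alpha K i * Y.1 i + G.beta K i * Y.2.1 i + G.gamma K i * Y.2.2.1 i := by fun_prop
  simp only [hK.commLap_consensus_eq hk₄ (X _)]
  rw [hK.commLap_consensus_eq hk₄ Xbar, hXbar]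
  exact (((tendsto_pi_nhds.1 hrate i).sub ((hfeedback.tendsto _).comp hprimary)).const_mul
    _).const_mul _

end ClosedLoopConvergence

section Solutions

open ODEStability

variable {c : Fin N → ℝ} {ρ κ : ℝ}

theorem IsRegularLoad.contDiffAt_primaryLoop {Xbar : PrimaryState N M}
    (hreg : G.IsRegularLoad Xbar.1 c ρ) :
    ∀ X ∈ closedBall Xbar ρ, ContDiffAt ℝ 1 (G.primaryLoop K) X := fun _ hX =>
  Microgrid.contDiffAt_primaryLoop (hreg.contDiffAt _ (fst_mem_closedBall hX))

theorem IsRegularLoad.contDiffAt_closedLoop {Xbar : State N M}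
    (hreg : G.IsRegularLoad Xbar.voltage c ρ) :
    ∀ X ∈ closedBall Xbar ρ, ContDiffAt ℝ 1 (G.closedLoop K) X := fun X hX =>
  Microgrid.contDiffAt_closedLoop (hreg.contDiffAt _ (fst_mem_closedBall (x := X) hX))

theorem IsRegularLoad.tendsto_primaryLoop {Xbar : PrimaryState N M} {X : ℝ → PrimaryState N M}
    (hreg : G.IsRegularLoad Xbar.1 c ρ) (hρ : 0 ≤ ρ) (hK : G.AdmissibleGains K)
    (hXbar : G.primaryLoop K Xbar = 0)
    (hlyap : IsLyapunovFunctionOn (G.primaryLoop K) (quadraticStorage (G.storageForm K) Xbar)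
      Xbar κ ρ)
    (hX : IsIntegralCurveOn X (fun _ => G.primaryLoop K) (Ici 0))
    (hball : ∀ t ∈ Ici (0 : ℝ), X t ∈ closedBall Xbar ρ) : Tendsto X atTop (𝓝 Xbar) := by
  have hcont : ContinuousOn (G.primaryLoop K) (closedBall Xbar ρ) := fun Y hY =>
    (hreg.contDiffAt_primaryLoop Y hY).continuousAt.continuousWithinAt
  refine hreg.tendsto_primary hρ hK (by rw [hXbar]; rfl)
    ((eventually_ge_atTop 0).mono fun t ht => fst_mem_closedBall (hball t ht)) ?_ fun hV =>
      tendsto_map_vectorField_zero (isCompact_closedBall Xbar ρ) hcont hX hball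
        (ContinuousLinearMap.fst ℝ _ _) hV
  simpa only [hK.storageForm_primaryLoop hXbar, neg_neg, neg_zero] using
    (hlyap.tendsto_bilinForm_zero (G.isSymm_storageForm K) hcont hX hball).neg

theorem IsRegularLoad.tendsto_closedLoop {Xbar : State N M} {X : ℝ → State N M}
    (hreg : G.IsRegularLoad Xbar.voltage c ρ) (hρ : 0 ≤ ρ) (hK : G.AdmissibleGains K)
    (hk₄ : ∀ i, K.k₄ i = K.k₁ i - 1) (hXbar : G.closedLoop K Xbar = 0)
    (hlyap : IsLyapunovFunctionOn (G.closedLoop K) (quadraticStorage (G.closedStorageForm K) Xbar)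
      Xbar κ ρ)
    (hX : IsIntegralCurveOn X (fun _ => G.closedLoop K) (Ici 0))
    (hball : ∀ t ∈ Ici (0 : ℝ), X t ∈ closedBall Xbar ρ) :
    Tendsto X atTop (𝓝 (Xbar.shiftTo (X 0))) := by
  have hcont : ContinuousOn (G.closedLoop K) (closedBall Xbar ρ) := fun Y hY =>
    (hreg.contDiffAt_closedLoop Y hY).continuousAt.continuousWithinAt
  have hdissipation : Tendsto (fun t => G.dissipation K (State.primary Xbar) (State.primary (X t)))
      atTop (𝓝 0) := by
    simpa only [hK.closedStorageForm_closedLoop hk₄ hXbar, neg_neg, neg_zero] using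
      (hlyap.tendsto_bilinForm_zero (G.isSymm_closedStorageForm K) hcont hX hball).neg
  have hrate {F : Type} [NormedAddCommGroup F] [NormedSpace ℝ F] (A : State N M →L[ℝ] F) {a : F} :
      Tendsto (fun t => A (X t)) atTop (𝓝 a) →
        Tendsto (fun t => A (G.closedLoop K (X t))) atTop (𝓝 0) :=
    tendsto_map_vectorField_zero (isCompact_closedBall Xbar ρ) hcont hX hball A
  have hprimary : Tendsto (fun t => State.primary (X t)) atTop (𝓝 (State.primary Xbar)) :=
    IsRegularLoad.tendsto_primary (Y := State.primary Xbar) hreg hρ hK (congrArg Prod.fst hXbar)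
      ((eventually_ge_atTop 0).mono fun t ht => fst_mem_closedBall (x := X t) (hball t ht))
      hdissipation (hrate (ContinuousLinearMap.fst ℝ _ _))
  have hlap := hK.tendsto_commLap_consensus hk₄ hXbar hprimary
    (hrate ((ContinuousLinearMap.fst ℝ _ _).comp (ContinuousLinearMap.snd ℝ _ _))
      hprimary.snd_nhds.fst_nhds)
  refine State.tendsto_of_primary_of_consensus hprimary (G.tendsto_of_commLap ?_ ?_)
  · filter_upwards [eventually_ge_atTop 0] with t ht
    rw [State.sum_consensus_shiftTo G.natCast_ne_zero]
    exact sum_consensus_eq (convex_Ici 0) self_mem_Ici hX ht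
  · exact (G.commLap_add_const Xbar.consensus _).symm ▸ hlap

end Solutions

end Microgrid

/-! ### Stability of equilibria -/

namespace Microgrid

open Filter Metric Set ODEStability

variable {N M : ℕ} {G : Microgrid N M} {K : Gains N} {c : Fin N → ℝ} {ρ : ℝ}

section ClosedLoopStability

variable {Xbar : State N M}

theorem IsRegularLoad.isStableOn_closedLoop (hreg : G.IsRegularLoad Xbar.voltage c ρ) (hρ : 0 < ρ)
    (hK : G.AdmissibleGains K) (hk₄ : ∀ i, K.k₄ i = K.k₁ i - 1) (hXbar : G.closedLoop K Xbar = 0)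
    (S : Set (State N M)) : IsStableOn (G.closedLoop K) S Xbar := by
  obtain ⟨κ, -, hlyap⟩ := hK.exists_isLyapunovFunctionOn_closedLoop hk₄ hXbar
  exact (hlyap c ρ hreg).isStableOn hρ hreg.contDiffAt_closedLoop S

theorem IsRegularLoad.exists_forall_tendsto_shiftTo (hreg : G.IsRegularLoad Xbar.voltage c ρ)
    (hρ : 0 < ρ) (hK : G.AdmissibleGains K) (hk₄ : ∀ i, K.k₄ i = K.k₁ i - 1)
    (hXbar : G.closedLoop K Xbar = 0) :
    ∃ δ > 0, ∀ X : ℝ → State N M, IsIntegralCurveOn X (fun _ => G.closedLoop K) (Ici 0) →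
      dist (X 0) Xbar < δ → Tendsto X atTop (𝓝 (Xbar.shiftTo (X 0))) := by
  obtain ⟨κ, -, hlyap⟩ := hK.exists_isLyapunovFunctionOn_closedLoop hk₄ hXbar
  have hlyap := hlyap c ρ hreg
  obtain ⟨δ, hδ, hlt⟩ := hlyap.exists_pos_forall_lt hρ
  exact ⟨δ, hδ, fun X hX hdist => hreg.tendsto_closedLoop hρ.le hK hk₄ hXbar hlyap hX
    (hlyap.mem_closedBall_of_lt hρ.le hX (hlt _ hdist))⟩

theorem IsRegularLoad.isLocallyAsymptoticallyStableOn_leaf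
    (hreg : G.IsRegularLoad Xbar.voltage c ρ) (hρ : 0 < ρ) (hK : G.AdmissibleGains K)
    (hk₄ : ∀ i, K.k₄ i = K.k₁ i - 1) (hXbar : G.closedLoop K Xbar = 0) :
    IsLocallyAsymptoticallyStableOn (G.closedLoop K) Xbar.leaf Xbar := by
  obtain ⟨δ, hδ, htendsto⟩ := hreg.exists_forall_tendsto_shiftTo hρ hK hk₄ hXbar
  refine ⟨isForwardInvariant_leaf Xbar, hreg.isStableOn_closedLoop hρ hK hk₄ hXbar _, δ, hδ,
    fun X hX hleaf hdist => ?_⟩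
  simpa only [State.shiftTo_eq_self hleaf] using htendsto X hX hdist

theorem tendsto_shiftTo_of_forall_isRegularLoad (hreg : ∀ ρ, G.IsRegularLoad Xbar.voltage c ρ)
    (hK : G.AdmissibleGains K) (hk₄ : ∀ i, K.k₄ i = K.k₁ i - 1) (hXbar : G.closedLoop K Xbar = 0)
    {X : ℝ → State N M} (hX : IsIntegralCurveOn X (fun _ => G.closedLoop K) (Ici 0)) :
    Tendsto X atTop (𝓝 (Xbar.shiftTo (X 0))) := by
  obtain ⟨κ, hκ, hlyap⟩ := hK.exists_isLyapunovFunctionOn_closedLoop hk₄ hXbar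
  obtain ⟨r, hr, hlt⟩ :=
    exists_pos_lt_mul_sq hκ (quadraticStorage (G.closedStorageForm K) Xbar (X 0))
  have hlyap := hlyap c r (hreg r)
  exact (hreg r).tendsto_closedLoop hr.le hK hk₄ hXbar hlyap hX
    (hlyap.mem_closedBall_of_lt hr.le hX hlt)

theorem isGloballyAsymptoticallyStableOn_leaf (hreg : ∀ ρ, G.IsRegularLoad Xbar.voltage c ρ)
    (hK : G.AdmissibleGains K) (hk₄ : ∀ i, K.k₄ i = K.k₁ i - 1)
    (hXbar : G.closedLoop K Xbar = 0) :
    IsGloballyAsymptoticallyStableOn (G.closedLoop K) Xbar.leaf Xbar := by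
  obtain ⟨κ, hκ, hlyap⟩ := hK.exists_isLyapunovFunctionOn_closedLoop hk₄ hXbar
  refine ⟨isForwardInvariant_leaf Xbar,
    (hreg 1).isStableOn_closedLoop one_pos hK hk₄ hXbar _, fun X₀ _ => ?_, fun X hX hleaf => ?_⟩
  · obtain ⟨r, hr, hlt⟩ :=
      exists_pos_lt_mul_sq hκ (quadraticStorage (G.closedStorageForm K) Xbar X₀)
    exact (hlyap c (r + 1) (hreg _)).exists_integralCurveOn_Ici (hreg _).contDiffAt_closedLoop hr
      (lt_add_one r) hlt
  · simpa only [State.shiftTo_eq_self hleaf] using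
      tendsto_shiftTo_of_forall_isRegularLoad hreg hK hk₄ hXbar hX

theorem PL_eq_zero_of_ePower_eq_zero {V : Fin N → ℝ} (hV : ∀ i, 0 < V i)
    (hpower : ∀ i, G.ePower V i = 0) (i : Fin N) : G.PL i = 0 :=
  (mul_eq_zero.1 (hpower i)).resolve_right (Real.rpow_pos_of_pos (hV i) _).ne'

end ClosedLoopStability

theorem IsRegularLoad.isLocallyAsymptoticallyStableOn_primaryLoop {Xbar : PrimaryState N M}
    (hreg : G.IsRegularLoad Xbar.1 c ρ) (hρ : 0 < ρ) (hK : G.AdmissibleGains K)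
    (hXbar : G.primaryLoop K Xbar = 0) :
    IsLocallyAsymptoticallyStableOn (G.primaryLoop K) univ Xbar := by
  obtain ⟨κ, -, hlyap⟩ := hK.exists_isLyapunovFunctionOn_primaryLoop hXbar
  have hlyap := hlyap c ρ hreg
  obtain ⟨δ, hδ, hlt⟩ := hlyap.exists_pos_forall_lt hρ
  exact ⟨fun _ _ _ _ _ _ _ => mem_univ _, hlyap.isStableOn hρ hreg.contDiffAt_primaryLoop _, δ, hδ,
    fun X hX _ hdist => hreg.tendsto_primaryLoop hρ.le hK hXbar hlyap hX
      (hlyap.mem_closedBall_of_lt hρ.le hX (hlt _ hdist))⟩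

end Microgrid

end

theorem theorem2 {N M : ℕ} (G : Microgrid N M) (K : Gains N)
    (hK : G.AdmissibleGains K) (hk₄ : ∀ i, K.k₄ i = K.k₁ i - 1)
    (hP : ∀ i, 1 < G.r i → 0 ≤ G.PL i) :
    -- primary and secondary control
    (∀ Vbar : Fin N → ℝ, G.IsPositivePowerFlowSolution Vbar → G.LoadCondition Vbar →
      (∃ Xbar : State N M, Xbar.voltage = Vbar ∧ G.closedLoop K Xbar = 0) ∧
      ∀ Xbar : State N M, Xbar.voltage = Vbar → G.closedLoop K Xbar = 0 →
        (ODEStability.IsStableOn (G.closedLoop K) Set.univ Xbar ∧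
          ODEStability.IsLocallyAsymptoticallyStableOn (G.closedLoop K) Xbar.leaf Xbar ∧
          ∃ δ > 0, ∀ X : ℝ → State N M,
            IsIntegralCurveOn X (fun _ => G.closedLoop K) (Set.Ici 0) → dist (X 0) Xbar < δ →
            Filter.Tendsto X Filter.atTop (𝓝 (Xbar.shiftTo (X 0)))) ∧
        ((∀ i, G.ePower Vbar i = 0) →
          ODEStability.IsGloballyAsymptoticallyStableOn (G.closedLoop K) Xbar.leaf Xbar ∧
          ∀ X : ℝ → State N M,
            IsIntegralCurveOn X (fun _ => G.closedLoop K) (Set.Ici 0) →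
            Filter.Tendsto X Filter.atTop (𝓝 (Xbar.shiftTo (X 0))))) ∧
    -- primary control only
    (G.LoadCondition G.Vref →
      (∃! Xbar' : PrimaryState N M, G.primaryLoop K Xbar' = 0) ∧
      ∀ Xbar' : PrimaryState N M, G.primaryLoop K Xbar' = 0 →
        ODEStability.IsLocallyAsymptoticallyStableOn (G.primaryLoop K) Set.univ Xbar') := by
  refine ⟨fun Vbar hVbar hload => ⟨hVbar.exists_closedLoop_eq_zero hK, ?_⟩, fun hload =>
    ⟨hK.existsUnique_primaryLoop_eq_zero, fun Xbar hXbar => ?_⟩⟩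
  · rintro Xbar rfl hXbar
    obtain ⟨c, ρ, hρ, hreg⟩ := hload.exists_isRegularLoad hVbar.pos hP
    refine ⟨⟨hreg.isStableOn_closedLoop hρ hK hk₄ hXbar Set.univ,
      hreg.isLocallyAsymptoticallyStableOn_leaf hρ hK hk₄ hXbar,
      hreg.exists_forall_tendsto_shiftTo hρ hK hk₄ hXbar⟩, fun hpower => ?_⟩
    have hregular := Microgrid.isRegularLoad_YL
      (Microgrid.PL_eq_zero_of_ePower_eq_zero hVbar.pos hpower) Xbar.voltage
    exact ⟨Microgrid.isGloballyAsymptoticallyStableOn_leaf hregular hK hk₄ hXbar,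
      fun X => Microgrid.tendsto_shiftTo_of_forall_isRegularLoad hregular hK hk₄ hXbar⟩
  · obtain ⟨c, ρ, hρ, hreg⟩ := hload.exists_isRegularLoad G.Vref_pos hP
    rw [← Microgrid.fst_eq_Vref_of_primaryLoop_eq_zero hXbar] at hreg
    exact hreg.isLocallyAsymptoticallyStableOn_primaryLoop hρ hK hXbar
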